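/- Let $\langle x,y\rangle=x_1y_1+\dots+x_{n+1}y_{n+1}-x_{n+2}y_{n+2}$ and let $\mathcal M^n=\{[x]\in\mathbb{R}\mathrm{P}^{n+1}\mid\langle x,x\rangle=0\}$ be the Möbius quadric, with $n\in\{2,3\}$. A circle in $\mathcal M^n$ is the intersection of $\mathcal M^n$ with a $2$-dimensional projective subspace (a plane). An $(n-1)$-dimensional Darboux cyclide $\mathcal D$ in $\mathcal M^n$ is the intersection of $\mathcal M^n$ with a real quadric hypersurface $\mathcal Q\neq\mathcal M^n$ (given by a non-zero symmetric form, up to scale); for $n=2$ it is called a cyclic, and its imaginary points are the points of the intersection of the complexified quadrics. Let $M:\mathbb Z^2\to\mathcal M^n$ be a circular net: for all $(i,j)$ the points $M_{i,j},M_{i+1,j},M_{i+1,j+1},M_{i,j+1}$ lie on a circle. Suppose that, for every $i$, the points $\{M_{i,j}\}_{j\in\mathbb Z}$ lie on a circle $\mathcal V_i=V_i\cap\mathcal M^n$ and, for every $j$, the points $\{M_{i,j}\}_{i\in\mathbb Z}$ lie on a circle $\mathcal H_j=H_j\cap\mathcal M^n$, where $V_i$ and $H_j$ are planes. Assume the following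 non-degeneracy: the four vertices of each quad $M_{i,j},M_{i+1,j},M_{i+1,j+1},M_{i,j+1}$ are distinct, and so are any three consecutive vertices $M_{i,j},M_{i+1,j},M_{i+2,j}$ or $M_{i,j},M_{i,j+1},M_{i,j+2}$ of a parameter line. (i) Let $n=3$ and suppose that $V_i\ne V_{i+1}$ and $H_j\neq H_{j+1}$ for all $i,j$. Then there is a $2$-dimensional Darboux cyclide $\mathcal D$ in $\mathcal M^3$ that contains all the circles $\mathcal V_i$ and $\mathcal H_j$. (ii) Let $n=2$ and suppose that the net is generic in the following sense: no three of the planes $V_i$ and no three of the planes $H_j$ have a common line; the circles $\mathcal V_i$ do not all pass through one point, and neither do the circles $\mathcal H_j$; for all $i,j$ the three lines $M_{k,j}\vee M_{k,j+1}$, $k=i,i+1,i+2$, are not concurrent and the three lines $M_{i,l}\vee M_{i+1,l}$, $l=j,j+1,j+2$, are not concurrent. Then there is a cyclic $\mathcal D=\mathcal Q\cap\mathcal M^2$ such that: - the circles $\{\mathcal V_i\}_{i\in\mathbb Z}$ envelop $\mathcal D$, and so do the circles $\{\mathcal H_j\}_{j\in\mathbb Z}$: for each of the two families there is a quadratic cone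 $\mathcal K$ (a quadric of rank $3$) in the pencil spanned by $\mathcal Q$ and $\mathcal M^2$, with $\mathcal K\cap\mathcal M^2=\mathcal D$, such that the planes of all the circles of the family are tangent planes of $\mathcal K$; - each circle $\mathcal V_i$ and each circle $\mathcal H_j$ is twice tangent to $\mathcal D$: it has exactly two (possibly imaginary) points in common with $\mathcal D$, and at these points $\mathcal D$ is smooth and has the same tangent line as the circle. Here the two points are counted with multiplicity: they may coincide in one point of contact of order four (that is, some combination of the forms of $\mathcal Q$ and $\mathcal M^2$ with non-zero coefficient at $\mathcal Q$ restricts on the plane of the circle to the square of a linear form that defines the tangent line of the circle at that point), but this happens for at most four of the circles $\mathcal V_i$ and for at most four of the circles $\mathcal H_j$. -/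

import Mathlib

open scoped LinearAlgebra.Projectivization

namespace CircularNets

/-- Homogeneous coordinate vectors `(x_1, …, x_{n+2})` of the real projective space of
dimension `n + 1`. -/
abbrev Vec (n : ℕ) : Type := Fin (n + 2) → ℝ

/-- Complex homogeneous coordinate vectors. -/
abbrev CVec (n : ℕ) : Type := Fin (n + 2) → ℂ

/-- The real projective space of dimension `n + 1`. -/
abbrev RP (n : ℕ) : Type := ℙ ℝ (Vec n)

/-- Gram matrices of bilinear forms on `Vec n`. -/
abbrev Form (n : ℕ) : Type := Matrix (Fin (n + 2)) (Fin (n + 2)) ℝ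

/-- The matrix of the Lorentz product `x_1 y_1 + … + x_{n+1} y_{n+1} - x_{n+2} y_{n+2}`. -/
def lorentz (n : ℕ) : Form n :=
  Matrix.diagonal fun k => if k = Fin.last (n + 1) then -1 else 1

/-- The value `xᵀ A y` of the bilinear form with matrix `A`. -/
def bil {n : ℕ} (A : Form n) (x y : Vec n) : ℝ :=
  dotProduct x (A.mulVec y)

/-- The complexified covector `A p`, for a complex vector `p`. -/
noncomputable def cpolar {n : ℕ} (A : Form n) (p : CVec n) : CVec n :=
  (A.map (fun r : ℝ => (r : ℂ))).mulVec p

/-- The complex bilinear extension of `bil A`. -/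
noncomputable def cbil {n : ℕ} (A : Form n) (x y : CVec n) : ℂ :=
  dotProduct x (cpolar A y)

/-- The complexification of a real linear subspace. -/
noncomputable def complexify {n : ℕ} (W : Submodule ℝ (Vec n)) : Submodule ℂ (CVec n) :=
  Submodule.span ℂ ((fun (v : Vec n) (k : Fin (n + 2)) => ((v k : ℝ) : ℂ)) '' (W : Set (Vec n)))

/-- The real points of the quadric with matrix `A`. -/
def zeroLocus {n : ℕ} (A : Form n) : Set (RP n) :=
  {p | ∀ x ∈ p.submodule, bil A x x = 0}

/-- The Möbius quadric of dimension `n`. -/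
def moebiusQuadric (n : ℕ) : Set (RP n) := zeroLocus (lorentz n)

/-- The points of the Möbius quadric in the projective subspace given by `W`. For
`finrank W = 3` this is the circle cut out by a projective plane. -/
def sphere {n : ℕ} (W : Submodule ℝ (Vec n)) : Set (RP n) :=
  {p | p ∈ moebiusQuadric n ∧ p.submodule ≤ W}

/-- A circular net in the Möbius quadric of dimension `n`: the four vertices of each elementary
quadrilateral lie on a circle. The four vertices are distinct, and so are any three consecutive
vertices of a parameter line. -/
structure IsCircularNet {n : ℕ} (M : ℤ → ℤ → RP n) : Prop where
  mem : ∀ i j, M i j ∈ moebiusQuadric n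
  quad : ∀ i j, ∃ W : Submodule ℝ (Vec n), Module.finrank ℝ W = 3 ∧
    M i j ∈ sphere W ∧ M (i + 1) j ∈ sphere W ∧
    M (i + 1) (j + 1) ∈ sphere W ∧ M i (j + 1) ∈ sphere W
  ne_fst : ∀ i j, M i j ≠ M (i + 1) j
  ne_snd : ∀ i j, M i j ≠ M i (j + 1)
  ne_diag : ∀ i j, M i j ≠ M (i + 1) (j + 1)
  ne_antidiag : ∀ i j, M (i + 1) j ≠ M i (j + 1)
  ne_fst_two : ∀ i j, M i j ≠ M (i + 2) j
  ne_snd_two : ∀ i j, M i j ≠ M i (j + 2)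

/-- Both families of parameter lines are circular: the vertices `M i j`, `j ∈ ℤ`, lie on the circle
cut out by the plane `V i`, and the vertices `M i j`, `i ∈ ℤ`, on the circle cut out by the
plane `H j`. -/
structure HasCircularLines {n : ℕ} (M : ℤ → ℤ → RP n) (V H : ℤ → Submodule ℝ (Vec n)) : Prop where
  finrank_V : ∀ i, Module.finrank ℝ (V i) = 3
  finrank_H : ∀ j, Module.finrank ℝ (H j) = 3
  mem_V : ∀ i j, M i j ∈ sphere (V i)
  mem_H : ∀ i j, M i j ∈ sphere (H j)

/-- General position of a family of planes and of the circles cut out by them: no three of the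
planes have a common line (no three of the circles are coaxial), and the circles do not all pass
through one point. -/
structure GeneralPosition {n : ℕ} (W : ℤ → Submodule ℝ (Vec n)) : Prop where
  not_coaxial : ∀ i k l, i ≠ k → k ≠ l → i ≠ l →
    Module.finrank ℝ (W i ⊓ W k ⊓ W l : Submodule ℝ (Vec n)) ≤ 1
  no_common_point : ¬ ∃ p : RP n, ∀ i, p ∈ sphere (W i)

/-- Three successive transversal edges of a strip of the net never lie on concurrent lines. -/
structure EdgesNotConcurrent {n : ℕ} (M : ℤ → ℤ → RP n) : Prop where
  fst : ∀ i j,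
    ((M i j).submodule ⊔ (M i (j + 1)).submodule) ⊓
    ((M (i + 1) j).submodule ⊔ (M (i + 1) (j + 1)).submodule) ⊓
    ((M (i + 2) j).submodule ⊔ (M (i + 2) (j + 1)).submodule) = ⊥
  snd : ∀ i j,
    ((M i j).submodule ⊔ (M (i + 1) j).submodule) ⊓
    ((M i (j + 1)).submodule ⊔ (M (i + 1) (j + 1)).submodule) ⊓
    ((M i (j + 2)).submodule ⊔ (M (i + 1) (j + 2)).submodule) = ⊥

/-- An `(n - 1)`-dimensional Darboux cyclide in the Möbius quadric: its intersection with a real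
quadric other than the Möbius quadric itself. For `n = 2` this is a cyclic. (The choice `c = 0` in
`ne_lorentz` says that the form is not zero.) -/
structure DarbouxCyclide (n : ℕ) where
  form : Form n
  symm : form.IsSymm
  ne_lorentz : ∀ c : ℝ, form ≠ c • lorentz n

namespace DarbouxCyclide

/-- The real points of a Darboux cyclide. -/
def points {n : ℕ} (D : DarbouxCyclide n) : Set (RP n) :=
  moebiusQuadric n ∩ zeroLocus D.form

/-- `p` is a non-zero vector that represents a real or imaginary point of the cyclide. -/
def IsPoint {n : ℕ} (D : DarbouxCyclide n) (p : CVec n) : Prop :=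
  p ≠ 0 ∧ cbil (lorentz n) p p = 0 ∧ cbil D.form p p = 0

/-- The circle cut out by the plane `W` is tangent to the cyclic `D` at the (real or imaginary)
point `p`: `p` is a common point, `D` is smooth at `p` (the tangent planes at `p` of the two
quadrics that cut out `D` are distinct), and the tangent line of `D` at `p`, i.e. the intersection
of those two tangent planes, is the tangent line of the circle at `p`. -/
def TangentAt (D : DarbouxCyclide 2) (W : Submodule ℝ (Vec 2)) (p : CVec 2) : Prop :=
  D.IsPoint p ∧ p ∈ complexify W ∧
  LinearIndependent ℂ ![cpolar (lorentz 2) p, cpolar D.form p] ∧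
  ∀ w : CVec 2, (cbil (lorentz 2) w p = 0 ∧ cbil D.form w p = 0) ↔
    (w ∈ complexify W ∧ cbil (lorentz 2) w p = 0)

/-- The circle cut out by `W` is tangent to `D` at exactly two distinct (real or imaginary)
points, and has no other point in common with `D`. -/
def TangentAtTwoPoints (D : DarbouxCyclide 2) (W : Submodule ℝ (Vec 2)) : Prop :=
  ∃ p q : CVec 2, LinearIndependent ℂ ![p, q] ∧ D.TangentAt W p ∧ D.TangentAt W q ∧
    ∀ r : CVec 2, r ∈ complexify W → D.IsPoint r →
      r ∈ Submodule.span ℂ {p} ∨ r ∈ Submodule.span ℂ {q}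

/-- The circle cut out by `W` is tangent to `D` at a point `p` with contact of order four: in the
plane `W`, the pencil of the two conics contains the double tangent line at `p`. This is the
case of two coinciding tangency points. -/
def TangentAtDoublePoint (D : DarbouxCyclide 2) (W : Submodule ℝ (Vec 2)) : Prop :=
  ∃ p : CVec 2, D.TangentAt W p ∧ ∃ s t : ℂ, t ≠ 0 ∧ ∀ w ∈ complexify W,
    cbil D.form w w = s * cbil (lorentz 2) w w + t * cbil (lorentz 2) w p ^ 2

/-- The circle cut out by `W` is twice tangent to `D`; the two tangency points are counted with
multiplicity. -/
def TwiceTangent (D : DarbouxCyclide 2) (W : Submodule ℝ (Vec 2)) : Prop :=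
  D.TangentAtTwoPoints W ∨ D.TangentAtDoublePoint W

end DarbouxCyclide

/-- `W` is the tangent plane of the quadric `K` at a regular point `p` of `K`. -/
def IsTangentPlane (K : Form 2) (W : Submodule ℝ (Vec 2)) : Prop :=
  ∃ p : Vec 2, K.mulVec p ≠ 0 ∧ bil K p p = 0 ∧ ∀ w : Vec 2, w ∈ W ↔ bil K w p = 0

/-- The circles cut out by the planes `W i` envelop the cyclic `D`: they belong to one of the
one-parameter families of circles of which `D` is the envelope. Such a family consists of the
circles cut out by the tangent planes of a quadratic cone `K` that, together with the Möbius
quadric, cuts out `D`; i.e. `K` is a quadric of rank three, other than the Möbius quadric, in the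
pencil spanned by the Möbius quadric and the quadric of `D`. -/
def Envelop (W : ℤ → Submodule ℝ (Vec 2)) (D : DarbouxCyclide 2) : Prop :=
  ∃ a b : ℝ, b ≠ 0 ∧ (a • lorentz 2 + b • D.form).rank = 3 ∧
    ∀ i, IsTangentPlane (a • lorentz 2 + b • D.form) (W i)

end CircularNets

/-! Vertices are represented by null vectors `m i j`. Distinct null vectors are not orthogonal, so
three distinct points of a circle span its plane, and each quad carries a linear relation with four
nonzero coefficients. Hence the two edges of a quad that lie on neighbouring circles of a family
meet in a point common to both planes.

In dimension three, let a form equal `c` times the Lorentz product on the plane of one circle and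
vanish at three consecutive vertices of the next circle. The sides of that triangle meet the first
plane, and the values there determine the form on the second plane: it is again `c` times the
Lorentz product (`NullNet.agreesOn_of_strip`). A symmetric form in five variables has 15
coefficients. Six conditions make it vanish on `H 0`, three more on `H 1`, three more on `H 2`, and
two make it proportional to the Lorentz product on `V 0`. These 14 conditions leave a nonzero form;
propagation across strips carries it to every `V i`, and then to every `H j`.

In dimension two, the planes have unit normals `v i` and `h j`. An edge joining `H j` to `H (j + 1)`
spans a hyperbolic plane whose orthogonal complement is Euclidean; the projections of `h j` and `h
(j + 1)` to it enclose an angle with cosine `edgeCos` and sine `edgeSin`. Passing to the next edge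
of the strip is a reflection fixing both normals, so the cosine stays and the sine changes sign
(`edge_next`). Since `v i` lies in the same Euclidean plane, the addition formula gives linear and
quadratic equations for `v i` (`StripData`). Comparing two neighbouring strips yields a vector
`apex` orthogonal to every `v i`, so all planes `V i` share a point `k`.

Geometrically, each strip spans a ruled quadric through its two circles. The planes `V i` contain
its rulings, hence touch it, hence touch its tangent cone `K` from `k`. All strips give the same
cone, because their dual quadrics agree on the polar plane of `k` modulo `k`
(`StripData.ruledDual_succ`). Up to a factor, `K - lorentz 2` is the product of the two linear forms
of the circles minus the square of a linear form, so it is singular and touches all planes `H j`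
(`StripData.exists_cone`). The cyclic is cut out by `K`, and `K`, `K - lorentz 2` are the two
enveloping cones.

On a tangent plane a cone restricts to a squared linear form, so the circle meets the cyclic only on
the line of contact. This gives two tangency points, or one double point; double points lie on two
different conics in the polar plane of the apex, which bounds their number by four
(`encard_le_four`). -/

namespace CircularNets

/-! ### Null vectors and signature of the Lorentz product -/

section Lorentz

variable {n : ℕ}

theorem bil_add_left (A : Form n) (x y z : Vec n) : bil A (x + y) z = bil A x z + bil A y z := by
  simp [bil, add_dotProduct]

theorem bil_add_right (A : Form n) (x y z : Vec n) : bil A x (y + z) = bil A x y + bil A x z := by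
  simp [bil, Matrix.mulVec_add, dotProduct_add]

theorem bil_sub_left (A : Form n) (x y z : Vec n) : bil A (x - y) z = bil A x z - bil A y z := by
  simp [bil, sub_dotProduct]

theorem bil_sub_right (A : Form n) (x y z : Vec n) : bil A x (y - z) = bil A x y - bil A x z := by
  simp [bil, Matrix.mulVec_sub, dotProduct_sub]

theorem bil_smul_left (A : Form n) (c : ℝ) (x y : Vec n) : bil A (c • x) y = c * bil A x y := by
  simp [bil]

theorem bil_smul_right (A : Form n) (c : ℝ) (x y : Vec n) : bil A x (c • y) = c * bil A x y := by
  simp [bil, Matrix.mulVec_smul]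

theorem bil_zero_left (A : Form n) (y : Vec n) : bil A 0 y = 0 := by simp [bil]

theorem bil_zero_right (A : Form n) (y : Vec n) : bil A y 0 = 0 := by simp [bil]

theorem bil_comm {A : Form n} (hA : A.IsSymm) (x y : Vec n) : bil A x y = bil A y x := by
  rw [bil, bil, Matrix.dotProduct_mulVec, dotProduct_comm, ← Matrix.mulVec_transpose, hA.eq]

theorem lorentz_isSymm : (lorentz n).IsSymm := Matrix.isSymm_diagonal _

/-- The Lorentz product. -/
abbrev lp (x y : Vec n) : ℝ := bil (lorentz n) x y

theorem lp_add_left (x y z : Vec n) : lp (x + y) z = lp x z + lp y z := bil_add_left _ x y z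

theorem lp_add_right (x y z : Vec n) : lp x (y + z) = lp x y + lp x z := bil_add_right _ x y z

theorem lp_sub_left (x y z : Vec n) : lp (x - y) z = lp x z - lp y z := bil_sub_left _ x y z

theorem lp_sub_right (x y z : Vec n) : lp x (y - z) = lp x y - lp x z := bil_sub_right _ x y z

theorem lp_smul_left (c : ℝ) (x y : Vec n) : lp (c • x) y = c * lp x y := bil_smul_left _ c x y

theorem lp_smul_right (c : ℝ) (x y : Vec n) : lp x (c • y) = c * lp x y := bil_smul_right _ c x y

theorem lp_comm (x y : Vec n) : lp x y = lp y x := bil_comm lorentz_isSymm x y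

theorem lp_eq (x y : Vec n) : lp x y =
    ∑ k : Fin (n + 1), x k.castSucc * y k.castSucc - x (Fin.last _) * y (Fin.last _) := by
  simp only [lp, bil, lorentz, Matrix.mulVec_diagonal, dotProduct]
  rw [Fin.sum_univ_castSucc]
  simp [Fin.castSucc_ne_last, sub_eq_add_neg]

theorem last_ne_zero_of_null {x : Vec n} (hx : lp x x = 0) (h0 : x ≠ 0) : x (Fin.last _) ≠ 0 := by
  intro hl
  apply h0
  rw [lp_eq, hl, mul_zero, sub_zero,
    Finset.sum_eq_zero_iff_of_nonneg fun _ _ => mul_self_nonneg _] at hx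
  funext k
  refine Fin.lastCases hl (fun i => ?_) k
  simpa using hx i (Finset.mem_univ _)

/-- Orthogonal null vectors are proportional. -/
theorem null_orthogonal {x y : Vec n} (hx : lp x x = 0) (hy : lp y y = 0) (hxy : lp x y = 0) :
    y (Fin.last _) • x = x (Fin.last _) • y := by
  rw [lp_eq] at hx hy hxy
  -- Equality case of the Cauchy–Schwarz inequality for the spatial parts: the squared distance
  -- expands into the three vanishing products.
  have h : ∑ k : Fin (n + 1),
      (y (Fin.last _) * x k.castSucc - x (Fin.last _) * y k.castSucc) ^ 2 = 0 := by
    have e : ∀ k : Fin (n + 1),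
        (y (Fin.last _) * x k.castSucc - x (Fin.last _) * y k.castSucc) ^ 2 =
        y (Fin.last _) ^ 2 * (x k.castSucc * x k.castSucc)
        - 2 * x (Fin.last _) * y (Fin.last _) * (x k.castSucc * y k.castSucc)
        + x (Fin.last _) ^ 2 * (y k.castSucc * y k.castSucc) := fun k => by ring
    simp_rw [e]
    rw [Finset.sum_add_distrib, Finset.sum_sub_distrib, ← Finset.mul_sum, ← Finset.mul_sum,
      ← Finset.mul_sum]
    linear_combination y (Fin.last _) ^ 2 * hx - 2 * x (Fin.last _) * y (Fin.last _) * hxy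
      + x (Fin.last _) ^ 2 * hy
  rw [Finset.sum_eq_zero_iff_of_nonneg fun _ _ => sq_nonneg _] at h
  funext k
  refine Fin.lastCases ?_ (fun i => ?_) k
  · simp [mul_comm]
  · have := h i (Finset.mem_univ _)
    simpa [sub_eq_zero] using this

/-- A vector orthogonal to a null vector is not timelike. -/
theorem lp_self_nonneg_of_orthogonal {d x : Vec n} (hx : lp x x = 0) (h0 : x ≠ 0)
    (hd : lp d x = 0) : 0 ≤ lp d d := by
  have hl := last_ne_zero_of_null hx h0
  rw [lp_eq] at *
  have cs := Finset.sum_mul_sq_le_sq_mul_sq Finset.univ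
    (fun k : Fin (n + 1) => d k.castSucc) (fun k => x k.castSucc)
  simp_rw [pow_two (d _), pow_two (x _)] at cs
  rw [sub_eq_zero.mp hx, sub_eq_zero.mp hd] at cs
  have hp : 0 < x (Fin.last _) * x (Fin.last _) := mul_self_pos.mpr hl
  have := le_of_mul_le_mul_right (a := x (Fin.last _) * x (Fin.last _))
    (b := d (Fin.last _) * d (Fin.last _)) (by linarith) hp
  linarith

/-- The orthogonal complement of a hyperbolic plane is positive definite. -/
theorem eq_zero_of_orthogonal_pair {d x y : Vec n} (hx : lp x x = 0) (hxy : lp x y ≠ 0)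
    (hdx : lp d x = 0) (hdy : lp d y = 0) (hd : lp d d = 0) : d = 0 := by
  have h0 : x ≠ 0 := by rintro rfl; exact hxy (bil_zero_left _ _)
  have hl := last_ne_zero_of_null hx h0
  have h := null_orthogonal hd hx hdx
  have h' : lp (x (Fin.last _) • d) y = lp (d (Fin.last _) • x) y := by rw [h]
  rw [lp_smul_left, lp_smul_left, hdy, mul_zero, zero_eq_mul] at h'
  have h'' := h'.resolve_right hxy
  rw [h'', zero_smul] at h
  exact (smul_eq_zero.mp h).resolve_left hl

theorem lp_self_pos_of_orthogonal_pair {d x y : Vec n} (hx : lp x x = 0) (hxy : lp x y ≠ 0)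
    (hdx : lp d x = 0) (hdy : lp d y = 0) (hd : d ≠ 0) : 0 < lp d d := by
  have h0 : x ≠ 0 := by rintro rfl; exact hxy (bil_zero_left _ _)
  refine lt_of_le_of_ne (lp_self_nonneg_of_orthogonal hx h0 hdx) fun h => hd ?_
  exact eq_zero_of_orthogonal_pair hx hxy hdx hdy h.symm

/-- Vectors that are null for a symmetric form and pairwise not orthogonal are independent. -/
theorem coeff_eq_zero_of_null_triple {A : Form n} (hA : A.IsSymm) {x y z : Vec n}
    (hx : bil A x x = 0) (hy : bil A y y = 0) (hz : bil A z z = 0) (hxy : bil A x y ≠ 0)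
    (hxz : bil A x z ≠ 0) (hyz : bil A y z ≠ 0) {a b c : ℝ} (h : a • x + b • y + c • z = 0) :
    a = 0 ∧ b = 0 ∧ c = 0 := by
  have e : ∀ w, a * bil A x w + b * bil A y w + c * bil A z w = 0 := fun w => by
    rw [← bil_smul_left, ← bil_smul_left, ← bil_smul_left, ← bil_add_left, ← bil_add_left, h,
      bil_zero_left]
  have ex := e x
  have ey := e y
  have ez := e z
  rw [hx, bil_comm hA y x, bil_comm hA z x] at ex
  rw [hy, bil_comm hA z y] at ey
  rw [hz] at ez
  -- A symmetric 3×3 matrix with zero diagonal has determinant twice the product of its off-diagonal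
  -- entries; this combination eliminates `a` and `b`.
  have hc : c = 0 := by
    have : 2 * bil A x z * bil A y z * c = 0 := by
      linear_combination bil A y z * ex + bil A x z * ey - bil A x y * ez
    simpa [hxz, hyz] using this
  subst hc
  simp only [mul_zero, zero_mul, add_zero, zero_add] at ex ey
  exact ⟨by simpa [hxy] using ey, by simpa [hxy] using ex, rfl⟩

theorem linearIndependent_of_coeff {x y z : Vec n}
    (h : ∀ a b c : ℝ, a • x + b • y + c • z = 0 → a = 0 ∧ b = 0 ∧ c = 0) :
    LinearIndependent ℝ ![x, y, z] := by
  rw [Fintype.linearIndependent_iff]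
  intro g hg
  simp only [Fin.sum_univ_three, Matrix.cons_val_zero, Matrix.cons_val_one,
    Matrix.cons_val_two, Matrix.tail_cons, Matrix.head_cons] at hg
  obtain ⟨h0, h1, h2⟩ := h _ _ _ hg
  intro i
  fin_cases i <;> assumption

theorem exists_coeff_of_mem {W : Submodule ℝ (Vec n)} (hW : Module.finrank ℝ W = 3)
    {x y z : Vec n} (h : LinearIndependent ℝ ![x, y, z]) (hx : x ∈ W) (hy : y ∈ W) (hz : z ∈ W)
    {w : Vec n} (hw : w ∈ W) : ∃ a b c : ℝ, w = a • x + b • y + c • z := by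
  have hs : Submodule.span ℝ (Set.range ![x, y, z]) = W := by
    apply Submodule.eq_of_le_of_finrank_eq
    · rw [Submodule.span_le]
      rintro _ ⟨i, rfl⟩
      fin_cases i <;> assumption
    · rw [finrank_span_eq_card h, hW]; rfl
  rw [← hs, Submodule.mem_span_range_iff_exists_fun] at hw
  obtain ⟨c, hc⟩ := hw
  refine ⟨c 0, c 1, c 2, ?_⟩
  rw [← hc]
  simp [Fin.sum_univ_three]

end Lorentz

/-! ### Null vector representatives of a circular net -/

section Nets

variable {n : ℕ}

theorem mem_sphere_iff {W : Submodule ℝ (Vec n)} {p : RP n} :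
    p ∈ sphere W ↔ lp p.rep p.rep = 0 ∧ p.rep ∈ W := by
  rw [sphere, Set.mem_ofPred_eq, moebiusQuadric, zeroLocus, Set.mem_ofPred_eq,
    Projectivization.submodule_eq, Submodule.span_singleton_le_iff_mem]
  refine and_congr_left fun _ => ⟨fun h => h _ (Submodule.mem_span_singleton_self _), ?_⟩
  intro h x hx
  obtain ⟨c, rfl⟩ := Submodule.mem_span_singleton.mp hx
  rw [bil_smul_left, bil_smul_right]
  change lp _ _ = 0 at h
  simp [h]

theorem lp_rep_ne_zero {p q : RP n} (hp : lp p.rep p.rep = 0) (hq : lp q.rep q.rep = 0)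
    (h : p ≠ q) : lp p.rep q.rep ≠ 0 := by
  intro h0
  apply h
  have hl := null_orthogonal hp hq h0
  have h1 := last_ne_zero_of_null hp p.rep_nonzero
  have h2 := last_ne_zero_of_null hq q.rep_nonzero
  rw [← p.mk_rep, ← q.mk_rep, Projectivization.mk_eq_mk_iff']
  refine ⟨(q.rep (Fin.last _))⁻¹ * p.rep (Fin.last _), ?_⟩
  rw [mul_smul, ← hl, smul_smul, inv_mul_cancel₀ h2, one_smul]

/-- Null vectors that represent the vertices of a circular net. -/
structure NullNet (m : ℤ → ℤ → Vec n) : Prop where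
  null : ∀ i j, lp (m i j) (m i j) = 0
  fst : ∀ i j, lp (m i j) (m (i + 1) j) ≠ 0
  snd : ∀ i j, lp (m i j) (m i (j + 1)) ≠ 0
  diag : ∀ i j, lp (m i j) (m (i + 1) (j + 1)) ≠ 0
  antidiag : ∀ i j, lp (m (i + 1) j) (m i (j + 1)) ≠ 0
  fst_two : ∀ i j, lp (m i j) (m (i + 2) j) ≠ 0
  snd_two : ∀ i j, lp (m i j) (m i (j + 2)) ≠ 0
  quad : ∀ i j, ∃ a b c d : ℝ, a ≠ 0 ∧ b ≠ 0 ∧ c ≠ 0 ∧ d ≠ 0 ∧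
    a • m i j + b • m (i + 1) j + c • m i (j + 1) + d • m (i + 1) (j + 1) = 0

theorem NullNet.swap {m : ℤ → ℤ → Vec n} (h : NullNet m) : NullNet fun i j => m j i where
  null i j := h.null j i
  fst i j := h.snd j i
  snd i j := h.fst j i
  diag i j := h.diag j i
  antidiag i j := by
    rw [lp_comm]
    exact h.antidiag j i
  fst_two i j := h.snd_two j i
  snd_two i j := h.fst_two j i
  quad i j := by
    obtain ⟨a, b, c, d, ha, hb, hc, hd, e⟩ := h.quad j i
    exact ⟨a, c, b, d, ha, hc, hb, hd, by rw [← e]; abel⟩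

theorem NullNet.coeff_fst {m : ℤ → ℤ → Vec n} (h : NullNet m) (i j : ℤ) {a b c : ℝ}
    (e : a • m i j + b • m (i + 1) j + c • m (i + 2) j = 0) : a = 0 ∧ b = 0 ∧ c = 0 := by
  refine coeff_eq_zero_of_null_triple lorentz_isSymm (h.null _ _) (h.null _ _) (h.null _ _)
    (h.fst _ _) (h.fst_two _ _) ?_ e
  have := h.fst (i + 1) j
  rwa [add_assoc] at this

theorem NullNet.exists_coeff_fst {m : ℤ → ℤ → Vec n} (h : NullNet m) {H : Submodule ℝ (Vec n)}
    (hH : Module.finrank ℝ H = 3) (i j : ℤ) (hm : ∀ i, m i j ∈ H) {w : Vec n} (hw : w ∈ H) :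
    ∃ a b c : ℝ, w = a • m i j + b • m (i + 1) j + c • m (i + 2) j :=
  exists_coeff_of_mem hH (linearIndependent_of_coeff fun _ _ _ => h.coeff_fst i j)
    (hm _) (hm _) (hm _) hw

/-- The four vertices of a quad lie in a three-dimensional space, hence are dependent; any three of
them are independent, so no coefficient of the relation can vanish. -/
theorem IsCircularNet.nullNet {M : ℤ → ℤ → RP n} (h : IsCircularNet M) :
    NullNet fun i j => (M i j).rep := by
  have h0 : ∀ i j, lp (M i j).rep (M i j).rep = 0 := fun i j =>
    h.mem i j _ (by rw [Projectivization.submodule_eq]; exact Submodule.mem_span_singleton_self _)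
  have hne : ∀ {i j k l}, M i j ≠ M k l → lp (M i j).rep (M k l).rep ≠ 0 := fun e =>
    lp_rep_ne_zero (h0 _ _) (h0 _ _) e
  refine ⟨h0, fun i j => hne (h.ne_fst i j), fun i j => hne (h.ne_snd i j),
    fun i j => hne (h.ne_diag i j), fun i j => hne (h.ne_antidiag i j),
    fun i j => hne (h.ne_fst_two i j), fun i j => hne (h.ne_snd_two i j), fun i j => ?_⟩
  obtain ⟨W, hW, h1, h2, h3, h4⟩ := h.quad i j
  rw [mem_sphere_iff] at h1 h2 h3 h4
  have k12 := hne (h.ne_fst i j)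
  have k13 := hne (h.ne_snd i j)
  have k14 := hne (h.ne_diag i j)
  have k23 := hne (h.ne_antidiag i j)
  have k24 := hne (h.ne_snd (i + 1) j)
  have k34 := hne (h.ne_fst i (j + 1))
  obtain ⟨a, b, c, e⟩ := exists_coeff_of_mem hW (linearIndependent_of_coeff fun _ _ _ =>
    coeff_eq_zero_of_null_triple lorentz_isSymm (h0 i j) (h0 (i + 1) j) (h0 i (j + 1))
      k12 k13 k23) h1.2 h2.2 h4.2 h3.2
  refine ⟨a, b, c, -1, ?_, ?_, ?_, by norm_num, by rw [← e]; simp⟩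
  · rintro rfl
    have := coeff_eq_zero_of_null_triple (a := b) (b := c) (c := -1) lorentz_isSymm
      (h0 (i + 1) j) (h0 i (j + 1)) (h0 (i + 1) (j + 1)) k23 k24 k34 (by rw [e]; module)
    exact absurd this.2.2 (by norm_num)
  · rintro rfl
    have := coeff_eq_zero_of_null_triple (a := a) (b := c) (c := -1) lorentz_isSymm
      (h0 i j) (h0 i (j + 1)) (h0 (i + 1) (j + 1)) k13 k14 k34 (by rw [e]; module)
    exact absurd this.2.2 (by norm_num)
  · rintro rfl
    have := coeff_eq_zero_of_null_triple (a := a) (b := b) (c := -1) lorentz_isSymm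
      (h0 i j) (h0 (i + 1) j) (h0 (i + 1) (j + 1)) k12 k14 k24 (by rw [e]; module)
    exact absurd this.2.2 (by norm_num)

end Nets

/-! ### Dimension three: a quadric through all circles, by counting conditions -/

section Cyclide

variable {n : ℕ}

/-- `A` restricts to `c` times the Lorentz product on `W`. -/
def AgreesOn (A : Form n) (c : ℝ) (W : Submodule ℝ (Vec n)) : Prop :=
  ∀ x ∈ W, ∀ y ∈ W, bil A x y = c * lp x y

/-- The sides of a triangle in one circle of a strip meet the plane of the other circle; if the
form agrees with a multiple of the Lorentz product there, and vanishes at the vertices, then it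
agrees with that multiple on the plane of the triangle. -/
theorem NullNet.agreesOn_of_strip {m : ℤ → ℤ → Vec n} (h : NullNet m)
    {H : ℤ → Submodule ℝ (Vec n)} (hH : ∀ j, Module.finrank ℝ (H j) = 3)
    (hm : ∀ i j, m i j ∈ H j) {A : Form n} (hA : A.IsSymm) {c : ℝ} {j j' : ℤ}
    (hj : AgreesOn A c (H j)) (hz : ∀ i ∈ ({0, 1, 2} : Set ℤ), bil A (m i j') (m i j') = 0)
    (hq : ∀ i, ∃ α β γ δ : ℝ, α ≠ 0 ∧ β ≠ 0 ∧
      α • m i j' + β • m (i + 1) j' = γ • m i j + δ • m (i + 1) j) :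
    AgreesOn A c (H j') := by
  obtain ⟨α, β, γ, δ, hα, hβ, e⟩ := hq 0
  obtain ⟨α', β', γ', δ', hα', hβ', e'⟩ := hq 1
  norm_num at e e'
  have hP : α • m 0 j' + β • m 1 j' ∈ H j := by
    rw [e]; exact add_mem (Submodule.smul_mem _ _ (hm _ _)) (Submodule.smul_mem _ _ (hm _ _))
  have hP' : α' • m 1 j' + β' • m 2 j' ∈ H j := by
    rw [e']; exact add_mem (Submodule.smul_mem _ _ (hm _ _)) (Submodule.smul_mem _ _ (hm _ _))
  have z0 := hz 0 (by simp)
  have z1 := hz 1 (by simp)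
  have z2 := hz 2 (by simp)
  have l0 := h.null 0 j'
  have l1 := h.null 1 j'
  have l2 := h.null 2 j'
  have p00 := hj _ hP _ hP
  have p01 := hj _ hP _ hP'
  have p11 := hj _ hP' _ hP'
  simp only [lp] at p00 p01 p11 l0 l1 l2
  simp only [bil_add_left, bil_add_right, bil_smul_left, bil_smul_right, z0, z1, z2, l0, l1, l2,
    bil_comm hA (m 1 j') (m 0 j'), bil_comm hA (m 2 j') (m 1 j'),
    bil_comm lorentz_isSymm (m 1 j') (m 0 j'), bil_comm lorentz_isSymm (m 2 j') (m 1 j')]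
    at p00 p01 p11
  have q01 : bil A (m 0 j') (m 1 j') = c * lp (m 0 j') (m 1 j') := by
    apply mul_left_cancel₀ (mul_ne_zero hα hβ); linear_combination p00 / 2
  have q12 : bil A (m 1 j') (m 2 j') = c * lp (m 1 j') (m 2 j') := by
    apply mul_left_cancel₀ (mul_ne_zero hα' hβ'); linear_combination p11 / 2
  -- The third pair of vertices comes from the mixed product of the two side points; the squares of
  -- these points gave the other two pairs.
  have q02 : bil A (m 0 j') (m 2 j') = c * lp (m 0 j') (m 2 j') := by
    apply mul_left_cancel₀ (mul_ne_zero hα hβ')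
    linear_combination p01 - α * α' * q01 - β * β' * q12
  intro x hx y hy
  obtain ⟨a, b, d, rfl⟩ := h.exists_coeff_fst (hH j') 0 j' (fun i => hm i j') hx
  obtain ⟨a', b', d', rfl⟩ := h.exists_coeff_fst (hH j') 0 j' (fun i => hm i j') hy
  norm_num
  simp only [lp] at q01 q12 q02 ⊢
  simp only [bil_add_left, bil_add_right, bil_smul_left, bil_smul_right, z0, z1, z2, l0, l1, l2,
    bil_comm hA (m 1 j') (m 0 j'), bil_comm hA (m 2 j') (m 1 j'), bil_comm hA (m 2 j') (m 0 j'),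
    bil_comm lorentz_isSymm (m 1 j') (m 0 j'), bil_comm lorentz_isSymm (m 2 j') (m 1 j'),
    bil_comm lorentz_isSymm (m 2 j') (m 0 j'), q01, q12, q02]
  ring

/-- Each quad relation can be solved for either of its two opposite edges, so the propagation runs
across strips in both directions. -/
theorem NullNet.agreesOn_all {m : ℤ → ℤ → Vec n} (h : NullNet m)
    {H : ℤ → Submodule ℝ (Vec n)} (hH : ∀ j, Module.finrank ℝ (H j) = 3)
    (hm : ∀ i j, m i j ∈ H j) {A : Form n} (hA : A.IsSymm) {c : ℝ} (h0 : AgreesOn A c (H 0))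
    (hz : ∀ i ∈ ({0, 1, 2} : Set ℤ), ∀ j, bil A (m i j) (m i j) = 0) (j : ℤ) :
    AgreesOn A c (H j) := by
  induction j using Int.induction_on with
  | zero => exact h0
  | succ k ih =>
    refine h.agreesOn_of_strip hH hm hA ih (fun i hi => hz i hi _) fun i => ?_
    obtain ⟨a, b, c, d, ha, hb, hc, hd, e⟩ := h.quad i k
    exact ⟨c, d, -a, -b, hc, hd, by rw [← sub_eq_zero, ← e]; module⟩
  | pred k ih =>
    refine h.agreesOn_of_strip hH hm hA ih (fun i hi => hz i hi _) fun i => ?_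
    obtain ⟨a, b, c, d, ha, hb, hc, hd, e⟩ := h.quad i (-(k : ℤ) - 1)
    rw [sub_add_cancel] at e
    exact ⟨a, b, -c, -d, ha, hb, by rw [← sub_eq_zero, ← e]; module⟩

/-- Evaluation of forms at a pair of vectors. -/
def evalForm (x y : Vec n) : Form n →ₗ[ℝ] ℝ where
  toFun A := bil A x y
  map_add' A B := by simp [bil, Matrix.add_mulVec, dotProduct_add]
  map_smul' c A := by simp [bil, Matrix.smul_mulVec, dotProduct_smul]

/-- Fourteen linear conditions on a symmetric form in five variables have a common solution. -/
theorem exists_symm_form (f : Fin 14 → Form 3 →ₗ[ℝ] ℝ) :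
    ∃ A : Form 3, A ≠ 0 ∧ A.IsSymm ∧ ∀ i, f i A = 0 := by
  let e (p : {p : Fin 5 × Fin 5 // p.1 < p.2}) : Form 3 →ₗ[ℝ] ℝ :=
    Matrix.entryLinearMap ℝ ℝ p.1.1 p.1.2 - Matrix.entryLinearMap ℝ ℝ p.1.2 p.1.1
  -- Symmetry enters as 10 further equations on the 25 entries of a matrix, and 10 + 14 < 25.
  let Φ : Form 3 →ₗ[ℝ] ({p : Fin 5 × Fin 5 // p.1 < p.2} → ℝ) × (Fin 14 → ℝ) :=
    (LinearMap.pi e).prod (LinearMap.pi f)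
  have hlt : Module.finrank ℝ (({p : Fin 5 × Fin 5 // p.1 < p.2} → ℝ) × (Fin 14 → ℝ)) <
      Module.finrank ℝ (Form 3) := by
    rw [Module.finrank_prod, Module.finrank_fintype_fun_eq_card, Module.finrank_fin_fun,
      Module.finrank_matrix, Module.finrank_self]
    have : Fintype.card {p : Fin 5 × Fin 5 // p.1 < p.2} = 10 := by decide
    rw [this]; simp
  obtain ⟨A, hA, hA0⟩ := (LinearMap.ker Φ).ne_bot_iff.mp (LinearMap.ker_ne_bot_of_finrank_lt hlt)
  rw [LinearMap.mem_ker, Prod.ext_iff] at hA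
  have h1 : ∀ p : {p : Fin 5 × Fin 5 // p.1 < p.2}, A p.1.1 p.1.2 = A p.1.2 p.1.1 := fun p =>
    sub_eq_zero.mp (congrFun hA.1 p)
  refine ⟨A, hA0, Matrix.IsSymm.ext fun i j => ?_, fun i => congrFun hA.2 i⟩
  rcases lt_trichotomy i j with h | rfl | h
  · exact (h1 ⟨(i, j), h⟩).symm
  · rfl
  · exact h1 ⟨(j, i), h⟩

/-- Two side points of the triangle on the next circle already lie in `H j`, where the form
vanishes. Only the products of the middle vertex with these points and with itself remain, which is
why a further circle costs three conditions instead of six. -/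
theorem NullNet.agreesOn_zero_of_strip {m : ℤ → ℤ → Vec n} (h : NullNet m)
    {H : ℤ → Submodule ℝ (Vec n)} (hH : ∀ j, Module.finrank ℝ (H j) = 3)
    (hm : ∀ i j, m i j ∈ H j) {A : Form n} (hA : A.IsSymm) (j : ℤ) (hj : AgreesOn A 0 (H j))
    {α β α' β' : ℝ} (hα : α ≠ 0) (hβ' : β' ≠ 0)
    (hP : α • m 0 (j + 1) + β • m 1 (j + 1) ∈ H j)
    (hP' : α' • m 1 (j + 1) + β' • m 2 (j + 1) ∈ H j)
    (h0 : bil A (α • m 0 (j + 1) + β • m 1 (j + 1)) (m 1 (j + 1)) = 0)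
    (h1 : bil A (m 1 (j + 1)) (m 1 (j + 1)) = 0)
    (h2 : bil A (α' • m 1 (j + 1) + β' • m 2 (j + 1)) (m 1 (j + 1)) = 0) :
    AgreesOn A 0 (H (j + 1)) := by
  have p0 := hj _ hP _ hP
  have p1 := hj _ hP' _ hP'
  simp only [bil_add_left, bil_add_right, bil_smul_left, bil_smul_right, h1, zero_mul, mul_zero,
    add_zero, zero_add, bil_comm hA (m 1 (j + 1)) (m 0 (j + 1)),
    bil_comm hA (m 1 (j + 1)) (m 2 (j + 1)), mul_eq_zero, hα, hβ', false_or] at p0 p1 h0 h2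
  simp only [h0, h2, mul_zero, add_zero, zero_add, mul_eq_zero, hα, hβ', false_or] at p0 p1
  refine h.agreesOn_of_strip hH hm hA hj ?_ fun i => ?_
  · simp only [Set.mem_insert_iff, Set.mem_singleton_iff]
    rintro i (rfl | rfl | rfl) <;> assumption
  · obtain ⟨a, b, c, d, ha, hb, hc, hd, e⟩ := h.quad i j
    exact ⟨c, d, -a, -b, hc, hd, by rw [← sub_eq_zero, ← e]; module⟩

theorem NullNet.exists_mem_strip {m : ℤ → ℤ → Vec n} (h : NullNet m)
    {H : ℤ → Submodule ℝ (Vec n)} (hm : ∀ i j, m i j ∈ H j) (i j : ℤ) :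
    ∃ α β : ℝ, α ≠ 0 ∧ β ≠ 0 ∧ α • m i (j + 1) + β • m (i + 1) (j + 1) ∈ H j := by
  obtain ⟨a, b, c, d, ha, hb, hc, hd, e⟩ := h.quad i j
  refine ⟨c, d, hc, hd, ?_⟩
  have : c • m i (j + 1) + d • m (i + 1) (j + 1) = -(a • m i j + b • m (i + 1) j) := by
    rw [← sub_eq_zero, ← e]; module
  rw [this]
  exact neg_mem (add_mem (Submodule.smul_mem _ _ (hm _ _)) (Submodule.smul_mem _ _ (hm _ _)))

/-- A net with circular parameter lines in the Möbius quadric of dimension three lies on a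
further quadric. -/
theorem NullNet.exists_form {m : ℤ → ℤ → Vec 3} (h : NullNet m)
    {V H : ℤ → Submodule ℝ (Vec 3)} (hV : ∀ i, Module.finrank ℝ (V i) = 3)
    (hH : ∀ j, Module.finrank ℝ (H j) = 3) (hmV : ∀ i j, m i j ∈ V i) (hmH : ∀ i j, m i j ∈ H j) :
    ∃ A : Form 3, A ≠ 0 ∧ A.IsSymm ∧ (∀ j, AgreesOn A 0 (H j)) ∧
      ∃ c, ∀ i, AgreesOn A c (V i) := by
  obtain ⟨a, b, ha, hb, hP⟩ := h.exists_mem_strip hmH 0 0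
  obtain ⟨a', b', ha', hb', hP'⟩ := h.exists_mem_strip hmH 1 0
  obtain ⟨s, t, hs, ht, hS⟩ := h.exists_mem_strip hmH 0 1
  obtain ⟨s', t', hs', ht', hS'⟩ := h.exists_mem_strip hmH 1 1
  norm_num at hP hP' hS hS'
  -- The conditions 0–5 belong to `H 0`, 6–8 to `H 1`, 9–11 to `H 2`. The last two make the products
  -- of the three vertices on `V 0` proportional to their Lorentz products.
  obtain ⟨A, hA0, hA, hf⟩ := exists_symm_form ![
    evalForm (m 0 0) (m 0 0), evalForm (m 1 0) (m 1 0), evalForm (m 2 0) (m 2 0),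
    evalForm (m 0 0) (m 1 0), evalForm (m 0 0) (m 2 0), evalForm (m 1 0) (m 2 0),
    evalForm (a • m 0 1 + b • m 1 1) (m 1 1), evalForm (m 1 1) (m 1 1),
    evalForm (a' • m 1 1 + b' • m 2 1) (m 1 1),
    evalForm (s • m 0 2 + t • m 1 2) (m 1 2), evalForm (m 1 2) (m 1 2),
    evalForm (s' • m 1 2 + t' • m 2 2) (m 1 2),
    lp (m 0 0) (m 0 1) • evalForm (m 0 0) (m 0 2) - lp (m 0 0) (m 0 2) • evalForm (m 0 0) (m 0 1),
    lp (m 0 0) (m 0 1) • evalForm (m 0 1) (m 0 2) - lp (m 0 1) (m 0 2) • evalForm (m 0 0) (m 0 1)]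
  have e0 : bil A (m 0 0) (m 0 0) = 0 := hf 0
  have e1 : bil A (m 1 0) (m 1 0) = 0 := hf 1
  have e2 : bil A (m 2 0) (m 2 0) = 0 := hf 2
  have e3 : bil A (m 0 0) (m 1 0) = 0 := hf 3
  have e4 : bil A (m 0 0) (m 2 0) = 0 := hf 4
  have e5 : bil A (m 1 0) (m 2 0) = 0 := hf 5
  have e12 : lp (m 0 0) (m 0 1) * bil A (m 0 0) (m 0 2) -
    lp (m 0 0) (m 0 2) * bil A (m 0 0) (m 0 1) = 0 := hf 12
  have e13 : lp (m 0 0) (m 0 1) * bil A (m 0 1) (m 0 2) -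
    lp (m 0 1) (m 0 2) * bil A (m 0 0) (m 0 1) = 0 := hf 13
  have h0 : AgreesOn A 0 (H 0) := by
    intro x hx y hy
    obtain ⟨a, b, d, rfl⟩ := h.exists_coeff_fst (hH 0) 0 0 (fun i => hmH i 0) hx
    obtain ⟨a', b', d', rfl⟩ := h.exists_coeff_fst (hH 0) 0 0 (fun i => hmH i 0) hy
    norm_num
    simp only [bil_add_left, bil_add_right, bil_smul_left, bil_smul_right, e0, e1, e2, e3, e4, e5,
      bil_comm hA (m 1 0) (m 0 0), bil_comm hA (m 2 0) (m 1 0), bil_comm hA (m 2 0) (m 0 0)]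
    ring
  have h1 : AgreesOn A 0 (H 1) :=
    h.agreesOn_zero_of_strip hH hmH hA 0 h0 ha hb' (by simpa using hP) (by simpa using hP')
      (hf 6) (hf 7) (hf 8)
  have h2 : AgreesOn A 0 (H 2) :=
    h.agreesOn_zero_of_strip hH hmH hA 1 h1 hs ht' (by simpa using hS) (by simpa using hS')
      (hf 9) (hf 10) (hf 11)
  have hz : ∀ j ∈ ({0, 1, 2} : Set ℤ), ∀ i, bil A (m i j) (m i j) = 0 := by
    simp only [Set.mem_insert_iff, Set.mem_singleton_iff]
    rintro j (rfl | rfl | rfl) i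
    · simpa using h0 _ (hmH i 0) _ (hmH i 0)
    · simpa using h1 _ (hmH i 1) _ (hmH i 1)
    · simpa using h2 _ (hmH i 2) _ (hmH i 2)
  have hn : lp (m 0 0) (m 0 1) ≠ 0 := h.snd 0 0
  have hV0 : AgreesOn A (bil A (m 0 0) (m 0 1) / lp (m 0 0) (m 0 1)) (V 0) := by
    intro x hx y hy
    obtain ⟨a, b, d, rfl⟩ := h.swap.exists_coeff_fst (hV 0) 0 0 (fun j => hmV 0 j) hx
    obtain ⟨a', b', d', rfl⟩ := h.swap.exists_coeff_fst (hV 0) 0 0 (fun j => hmV 0 j) hy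
    norm_num
    have l0 := h.null 0 0
    have l1 := h.null 0 1
    have l2 := h.null 0 2
    simp only [lp] at e12 e13 hn l0 l1 l2 ⊢
    simp only [bil_add_left, bil_add_right, bil_smul_left, bil_smul_right,
      hz 0 (by simp) 0, hz 1 (by simp) 0, hz 2 (by simp) 0, l0, l1, l2,
      bil_comm hA (m 0 1) (m 0 0), bil_comm hA (m 0 2) (m 0 1), bil_comm hA (m 0 2) (m 0 0),
      bil_comm lorentz_isSymm (m 0 1) (m 0 0), bil_comm lorentz_isSymm (m 0 2) (m 0 1),
      bil_comm lorentz_isSymm (m 0 2) (m 0 0)]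
    field_simp
    linear_combination (a * d' + d * a') * e12 + (b * d' + d * b') * e13
  -- The vertices on `H 0`, `H 1`, `H 2` suffice to reach every `V i`. Only then is the form known
  -- to vanish at all vertices, which the propagation to every `H j` needs.
  have hVall := h.swap.agreesOn_all hV (fun i j => hmV j i) hA hV0 hz
  refine ⟨A, hA0, hA, h.agreesOn_all hH hmH hA h0 fun i _ j => ?_, _, hVall⟩
  rw [hVall i _ (hmV i j) _ (hmV i j), h.null, mul_zero]

theorem AgreesOn.sphere_subset {D : DarbouxCyclide n} {c : ℝ} {W : Submodule ℝ (Vec n)}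
    (h : AgreesOn D.form c W) : sphere W ⊆ D.points := by
  intro p hp
  refine ⟨hp.1, fun x hx => ?_⟩
  rw [h x (hp.2 hx) x (hp.2 hx), lp, hp.1 x hx, mul_zero]

theorem exists_darbouxCyclide {M : ℤ → ℤ → RP 3} {V H : ℤ → Submodule ℝ (Vec 3)}
    (hM : IsCircularNet M) (hc : HasCircularLines M V H) :
    ∃ D : DarbouxCyclide 3, (∀ i, sphere (V i) ⊆ D.points) ∧ (∀ j, sphere (H j) ⊆ D.points) := by
  have hmH : ∀ i j, (M i j).rep ∈ H j := fun i j => (mem_sphere_iff.mp (hc.mem_H i j)).2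
  obtain ⟨A, hA0, hA, h0, c, h1⟩ := hM.nullNet.exists_form hc.finrank_V hc.finrank_H
    (fun i j => (mem_sphere_iff.mp (hc.mem_V i j)).2) hmH
  let D : DarbouxCyclide 3 :=
    { form := A
      symm := hA
      -- The form vanishes on `H 0`, where two distinct vertices have nonzero Lorentz product.
      ne_lorentz := by
        rintro r rfl
        have := h0 0 _ (hmH 0 0) _ (hmH 1 0)
        have h2 : bil (r • lorentz 3) (M 0 0).rep (M 1 0).rep = r * lp (M 0 0).rep (M 1 0).rep := by
          simp [bil, Matrix.smul_mulVec, dotProduct_smul]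
        rw [h2, zero_mul, mul_eq_zero] at this
        refine hA0 ?_
        rw [this.resolve_right (hM.nullNet.fst 0 0), zero_smul] }
  exact ⟨D, fun i => AgreesOn.sphere_subset (D := D) (h1 i),
    fun j => AgreesOn.sphere_subset (D := D) (h0 j)⟩

end Cyclide

/-! ### Determinants and Gram determinants in four dimensions -/

section Volume

theorem lp_eq_sum (x y : Vec 2) : lp x y = x 0 * y 0 + x 1 * y 1 + x 2 * y 2 - x 3 * y 3 := by
  rw [lp_eq, Fin.sum_univ_three]
  rfl

/-- The determinant of four homogeneous coordinate vectors. -/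
def vol (x y z w : Vec 2) : ℝ := Matrix.det (Matrix.of ![x, y, z, w])

theorem det_fin_four (A : Matrix (Fin 4) (Fin 4) ℝ) : A.det =
    A 0 0 * (A 1 1 * (A 2 2 * A 3 3 - A 2 3 * A 3 2) - A 1 2 * (A 2 1 * A 3 3 - A 2 3 * A 3 1)
      + A 1 3 * (A 2 1 * A 3 2 - A 2 2 * A 3 1))
    - A 0 1 * (A 1 0 * (A 2 2 * A 3 3 - A 2 3 * A 3 2) - A 1 2 * (A 2 0 * A 3 3 - A 2 3 * A 3 0)
      + A 1 3 * (A 2 0 * A 3 2 - A 2 2 * A 3 0))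
    + A 0 2 * (A 1 0 * (A 2 1 * A 3 3 - A 2 3 * A 3 1) - A 1 1 * (A 2 0 * A 3 3 - A 2 3 * A 3 0)
      + A 1 3 * (A 2 0 * A 3 1 - A 2 1 * A 3 0))
    - A 0 3 * (A 1 0 * (A 2 1 * A 3 2 - A 2 2 * A 3 1) - A 1 1 * (A 2 0 * A 3 2 - A 2 2 * A 3 0)
      + A 1 2 * (A 2 0 * A 3 1 - A 2 1 * A 3 0)) := by
  rw [Matrix.det_succ_row_zero]
  simp [Fin.sum_univ_succ, Matrix.det_fin_three, Matrix.submatrix, Fin.succAbove]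
  ring

theorem vol_eq (x y z w : Vec 2) : vol x y z w =
    x 0 * (y 1 * (z 2 * w 3 - z 3 * w 2) - y 2 * (z 1 * w 3 - z 3 * w 1)
      + y 3 * (z 1 * w 2 - z 2 * w 1))
    - x 1 * (y 0 * (z 2 * w 3 - z 3 * w 2) - y 2 * (z 0 * w 3 - z 3 * w 0)
      + y 3 * (z 0 * w 2 - z 2 * w 0))
    + x 2 * (y 0 * (z 1 * w 3 - z 3 * w 1) - y 1 * (z 0 * w 3 - z 3 * w 0)
      + y 3 * (z 0 * w 1 - z 1 * w 0))
    - x 3 * (y 0 * (z 1 * w 2 - z 2 * w 1) - y 1 * (z 0 * w 2 - z 2 * w 0)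
      + y 2 * (z 0 * w 1 - z 1 * w 0)) :=
  det_fin_four _

/-- The Gram matrix factors through `lorentz 2`, whose determinant is -1. This turns products of
sines into cosines below. -/
theorem vol_mul_vol (a b c d a' b' c' d' : Vec 2) : vol a b c d * vol a' b' c' d' =
    -Matrix.det !![lp a a', lp a b', lp a c', lp a d'; lp b a', lp b b', lp b c', lp b d';
      lp c a', lp c b', lp c c', lp c d'; lp d a', lp d b', lp d c', lp d d'] := by
  have hJ : (lorentz 2).det = -1 := by
    rw [lorentz, Matrix.det_diagonal, Fin.prod_univ_four]
    simp [Fin.ext_iff]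
  have h : (!![lp a a', lp a b', lp a c', lp a d'; lp b a', lp b b', lp b c', lp b d';
      lp c a', lp c b', lp c c', lp c d'; lp d a', lp d b', lp d c', lp d d'] :
      Matrix (Fin 4) (Fin 4) ℝ) = Matrix.of ![a, b, c, d] * lorentz 2 *
      (Matrix.of ![a', b', c', d']).transpose := by
    ext i j
    rw [Matrix.mul_assoc, Matrix.mul_apply]
    fin_cases i <;> fin_cases j <;>
      simp [lp, bil, dotProduct, Matrix.mulVec, Matrix.mul_apply]
  rw [h, Matrix.det_mul, Matrix.det_mul, Matrix.det_transpose, hJ]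
  simp [vol]

/-- Cramer's rule for expanding `d` in `a`, `b`, `c`, `e`, paired with `z`. -/
theorem vol_cramer (a b c e d z : Vec 2) : vol a b c e * lp d z = vol d b c e * lp a z +
    vol a d c e * lp b z + vol a b d e * lp c z + vol a b c d * lp e z := by
  simp only [vol_eq, lp_eq_sum]
  ring

theorem vol_eq_zero_of_orthogonal {a b c e z : Vec 2} (hz : z ≠ 0) (ha : lp a z = 0)
    (hb : lp b z = 0) (hc : lp c z = 0) (he : lp e z = 0) : vol a b c e = 0 := by
  by_contra h
  apply hz
  have key : ∀ d, lp d z = 0 := fun d => by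
    have := vol_cramer a b c e d z
    rw [ha, hb, hc, he] at this
    simpa [h] using this
  funext k
  have := key (Pi.single k 1)
  rw [lp_eq_sum] at this
  fin_cases k <;> simpa [Pi.single_apply] using this

theorem vol_smul (s t : ℝ) (a b c e : Vec 2) :
    vol (s • a) (t • b) c e = s * t * vol a b c e := by
  simp only [vol_eq, Pi.smul_apply, smul_eq_mul]
  ring

theorem vol_swap_fst (a b c e : Vec 2) : vol b a c e = -vol a b c e := by
  simp only [vol_eq]
  ring

theorem vol_swap_snd (a b c e : Vec 2) : vol a b e c = -vol a b c e := by
  simp only [vol_eq]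
  ring

end Volume

/-! ### Angles at the edges of a strip -/

section Strip

/-- The cosine of the angle at which two circles with unit normals `h` and `h'` are seen from the
edge `m`, `m'` that joins them. -/
noncomputable def edgeCos (m m' h h' : Vec 2) : ℝ := lp h h' - lp h' m * lp h m' / lp m m'

/-- The sine that belongs to `edgeCos`; its sign tells the orientation. -/
noncomputable def edgeSin (m m' h h' : Vec 2) : ℝ := vol m m' h' h / lp m m'

variable {m m' h h' v : Vec 2}

theorem edgeCos_smul {a b : ℝ} (ha : a ≠ 0) (hb : b ≠ 0) (m m' h h' : Vec 2) :
    edgeCos (a • m) (b • m') h h' = edgeCos m m' h h' := by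
  simp only [edgeCos, lp_smul_left, lp_smul_right]
  rw [show a * lp h' m * (b * lp h m') = a * b * (lp h' m * lp h m') by ring,
    show b * (a * lp m m') = a * b * lp m m' by ring, mul_div_mul_left _ _ (mul_ne_zero ha hb)]

theorem edgeSin_smul {a b : ℝ} (ha : a ≠ 0) (hb : b ≠ 0) (m m' h h' : Vec 2) :
    edgeSin (a • m) (b • m') h h' = edgeSin m m' h h' := by
  simp only [edgeSin, lp_smul_left, lp_smul_right, vol_smul]
  rw [show b * (a * lp m m') = a * b * lp m m' by ring, mul_div_mul_left _ _ (mul_ne_zero ha hb)]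

theorem edgeCos_swap (m m' h h' : Vec 2) : edgeCos m' m h' h = edgeCos m m' h h' := by
  rw [edgeCos, edgeCos, lp_comm h' h, lp_comm m' m, mul_comm (lp h m')]

theorem edgeSin_swap (m m' h h' : Vec 2) : edgeSin m' m h' h = edgeSin m m' h h' := by
  rw [edgeSin, edgeSin, vol_swap_fst, vol_swap_snd, lp_comm m' m, neg_neg]

/-- The angle addition formula at an edge. -/
theorem lp_sub_edgeCos_mul (hm : lp m m = 0) (hm' : lp m' m' = 0) (hmm : lp m m' ≠ 0)
    (h1 : lp h m = 0) (h2 : lp h' m' = 0) (h3 : lp h' h' = 1) (v1 : lp v m = 0)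
    (v2 : lp v m' = 0) :
    lp h v - edgeCos m m' h h' * lp h' v =
      edgeSin m m' h h' * (vol m m' h' v / lp m m') := by
  have := vol_mul_vol m m' h' h m m' h' v
  rw [det_fin_four] at this
  simp only [Matrix.of_apply, Matrix.cons_val] at this
  rw [hm, hm', h1, h2, h3, lp_comm m' m, lp_comm m v, lp_comm m' v, v1, v2, lp_comm m' h', h2,
    lp_comm m h'] at this
  rw [edgeCos, edgeSin]
  field_simp
  linear_combination (-1 : ℝ) * this

/-- The projections of `h` and `h'` to the Euclidean plane orthogonal to the edge keep unit length,
because each is orthogonal to one end of the edge; this is cos² + sin² = 1. -/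
theorem edge_sq (hm : lp m m = 0) (hm' : lp m' m' = 0) (hmm : lp m m' ≠ 0)
    (h1 : lp h m = 0) (h2 : lp h' m' = 0) (h3 : lp h' h' = 1) (h4 : lp h h = 1) :
    edgeSin m m' h h' ^ 2 = 1 - edgeCos m m' h h' ^ 2 := by
  have := vol_mul_vol m m' h' h m m' h' h
  rw [det_fin_four] at this
  simp only [Matrix.of_apply, Matrix.cons_val] at this
  rw [hm, hm', h1, h2, h3, h4, lp_comm m' m, lp_comm m h, lp_comm m' h', h1, h2,
    lp_comm m h', lp_comm m' h, lp_comm h' h] at this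
  rw [edgeCos, edgeSin]
  field_simp
  linear_combination this

theorem vol_div_sq (hm : lp m m = 0) (hm' : lp m' m' = 0) (hmm : lp m m' ≠ 0)
    (h2 : lp h' m' = 0) (h3 : lp h' h' = 1) (v1 : lp v m = 0) (v2 : lp v m' = 0) :
    (vol m m' h' v / lp m m') ^ 2 = lp v v - lp h' v ^ 2 := by
  have := lp_sub_edgeCos_mul hm hm' hmm v1 h2 h3 v1 v2
  rw [edgeCos, v2, edgeSin, mul_zero, zero_div, sub_zero, lp_comm v h'] at this
  rw [pow_two, ← this]
  ring

/-- If the sine vanishes, the edge passes through a point that depends only on the two circles. -/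
theorem sub_smul_eq_of_edgeCos_sq (hm : lp m m = 0) (hm' : lp m' m' = 0) (hmm : lp m m' ≠ 0)
    (h1 : lp h m = 0) (h2 : lp h' m' = 0) (h3 : lp h' h' = 1) (h4 : lp h h = 1)
    (hs : edgeCos m m' h h' ^ 2 = 1) : ∃ a b : ℝ,
    h - edgeCos m m' h h' • h' = a • m + b • m' := by
  -- These are the components of `h` and of the multiple of `h'` along the edge. The rest lies in
  -- the definite complement and has length zero when the projected normals are parallel.
  refine ⟨lp h m' / lp m m', -(edgeCos m m' h h' * lp h' m / lp m m'), ?_⟩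
  rw [← sub_eq_zero]
  apply eq_zero_of_orthogonal_pair hm hmm
  · simp only [lp_sub_left, lp_add_left, lp_smul_left, h1, hm, lp_comm m' m]
    field_simp
    ring
  · simp only [lp_sub_left, lp_add_left, lp_smul_left, h2, hm']
    field_simp
    ring
  · have e : edgeCos m m' h h' * lp m m' = lp h h' * lp m m' - lp h' m * lp h m' := by
      rw [edgeCos]; field_simp
    generalize edgeCos m m' h h' = s at *
    simp only [lp_sub_left, lp_add_left, lp_smul_left, lp_sub_right, lp_add_right, lp_smul_right,
      h1, h2, h3, h4, hm, hm', lp_comm m' m, lp_comm m h, lp_comm m' h', lp_comm m h',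
      lp_comm m' h, lp_comm h' h]
    field_simp
    linear_combination (2 * s * lp m m') * e - (lp m m') ^ 2 * hs

/-- Two edges that lie in a common plane are exchanged by a reflection that fixes the two
circles. -/
theorem edge_reflect {u u' d : Vec 2} (hd : lp d d ≠ 0) (hu : lp u u = 0) (hu' : lp u' u' = 0)
    (hud : lp (u - d) (u - d) = 0) (hud' : lp (u' + d) (u' + d) = 0) (h1 : lp h d = 0)
    (h2 : lp h' d = 0) :
    edgeCos (u - d) (u' + d) h h' = edgeCos u u' h h' ∧
      edgeSin (u - d) (u' + d) h h' = -edgeSin u u' h h' := by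
  -- This identity and the next say that `u - d` and `u' + d` are the images of `u` and `u'` under
  -- the reflection in the hyperplane orthogonal to `d`.
  have e1 : 2 * lp u d = lp d d := by
    simp only [lp_sub_left, lp_sub_right, hu, lp_comm d u] at hud
    linarith
  have e2 : 2 * lp u' d = -lp d d := by
    simp only [lp_add_left, lp_add_right, hu', lp_comm d u'] at hud'
    linarith
  have e3 : lp (u - d) (u' + d) = lp u u' := by
    simp only [lp_sub_left, lp_add_right, lp_comm d u']
    linarith
  have hv : vol (u - d) (u' + d) h' h = -vol u u' h' h := by
    have hc := vol_cramer u u' h' h d d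
    rw [h1, h2, mul_zero, mul_zero, add_zero, add_zero] at hc
    have hl : vol (u - d) (u' + d) h' h =
        vol u u' h' h + vol u d h' h - vol d u' h' h := by
      simp only [vol_eq, Pi.sub_apply, Pi.add_apply]
      ring
    rw [hl]
    apply mul_left_cancel₀ hd
    linear_combination 2 * hc + vol d u' h' h * e1 + vol u d h' h * e2
  constructor
  · rw [edgeCos, edgeCos, e3, lp_sub_right, lp_add_right, h1, h2, sub_zero, add_zero]
  · rw [edgeSin, edgeSin, e3, hv, neg_div]

theorem edge_next {m₀ m₁ m₀' m₁' : Vec 2} (n0 : lp m₀ m₀ = 0) (n1 : lp m₁ m₁ = 0)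
    (n0' : lp m₀' m₀' = 0) (n1' : lp m₁' m₁' = 0) (h01 : lp m₀ m₁ ≠ 0)
    (o0 : lp h m₀ = 0) (o1 : lp h m₁ = 0) (o0' : lp h' m₀' = 0) (o1' : lp h' m₁' = 0)
    {a b c d : ℝ} (ha : a ≠ 0) (hb : b ≠ 0) (hc : c ≠ 0) (hd : d ≠ 0)
    (e : a • m₀ + b • m₁ + c • m₀' + d • m₁' = 0) :
    edgeCos m₁ m₁' h h' = edgeCos m₀ m₀' h h' ∧
      edgeSin m₁ m₁' h h' = -edgeSin m₀ m₀' h h' := by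
  -- The mirror vector is `a • m₀ + b • m₁`, the common point of the two opposite edges; it lies in
  -- both circle planes, so both normals are fixed.
  have k1 : (-b) • m₁ = a • m₀ - (a • m₀ + b • m₁) := by module
  have k2 : (-d) • m₁' = c • m₀' + (a • m₀ + b • m₁) := by
    rw [← sub_eq_zero, ← neg_eq_zero, ← e]; module
  have k3 : a • m₀ + b • m₁ = -(c • m₀' + d • m₁') := by
    rw [← sub_eq_zero, ← e]; module
  rw [← edgeCos_smul (neg_ne_zero.mpr hb) (neg_ne_zero.mpr hd) m₁, ← edgeCos_smul ha hc m₀,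
    ← edgeSin_smul (neg_ne_zero.mpr hb) (neg_ne_zero.mpr hd) m₁, ← edgeSin_smul ha hc m₀, k1, k2]
  apply edge_reflect
  · simp only [lp_add_left, lp_add_right, lp_smul_left, lp_smul_right, n0, n1, lp_comm m₁ m₀]
    intro h
    apply mul_ne_zero (mul_ne_zero ha hb) h01
    linarith
  · simp only [lp_smul_left, lp_smul_right, n0, mul_zero]
  · simp only [lp_smul_left, lp_smul_right, n0', mul_zero]
  · rw [← k1]
    simp only [lp_smul_left, lp_smul_right, n1, mul_zero]
  · rw [← k2]
    simp only [lp_smul_left, lp_smul_right, n1', mul_zero]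
  · simp only [lp_add_right, lp_smul_right, o0, o1, mul_zero, add_zero]
  · rw [k3, ← neg_one_smul ℝ]
    simp only [lp_add_right, lp_smul_right, o0', o1', mul_zero, add_zero]

/-- The oriented angle of two circles at a common point does not depend on the auxiliary second
point of one of them. -/
theorem vol_div_eq {m m' m'' h' v : Vec 2} (hm' : lp m' m' = 0) (h0 : m' ≠ 0)
    (hmm : lp m m' ≠ 0) (hmm' : lp m'' m' ≠ 0) (h2 : lp h' m' = 0)
    (v2 : lp v m' = 0) :
    vol m'' m' h' v / lp m'' m' = vol m m' h' v / lp m m' := by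
  -- The first argument is chosen orthogonal to `m'`; then all four arguments are, and cannot be
  -- independent.
  have hz : vol (lp m m' • m'' - lp m'' m' • m) m' h' v = 0 := by
    apply vol_eq_zero_of_orthogonal h0 _ hm' h2 v2
    rw [lp_sub_left, lp_smul_left, lp_smul_left]
    ring
  have hl : vol (lp m m' • m'' - lp m'' m' • m) m' h' v =
      lp m m' * vol m'' m' h' v - lp m'' m' * vol m m' h' v := by
    generalize lp m m' = s
    generalize lp m'' m' = t
    simp only [vol_eq, Pi.sub_apply, Pi.smul_apply, smul_eq_mul]
    ring
  rw [hl] at hz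
  field_simp
  linear_combination hz

end Strip

/-! ### Unit normals and independence of planes -/

section Normals

variable {n : ℕ}

theorem lorentz_mul_lorentz : lorentz n * lorentz n = 1 := by
  rw [lorentz, Matrix.diagonal_mul_diagonal, ← Matrix.diagonal_one]
  congr 1
  funext k
  split_ifs <;> norm_num

theorem lorentz_mulVec_mulVec (x : Vec n) :
    (lorentz n).mulVec ((lorentz n).mulVec x) = x := by
  rw [Matrix.mulVec_mulVec, lorentz_mul_lorentz, Matrix.one_mulVec]

theorem bil_eq_mulVec_dotProduct {A : Form n} (hA : A.IsSymm) (x y : Vec n) :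
    bil A x y = dotProduct (A.mulVec x) y := by
  rw [bil_comm hA, bil, dotProduct_comm]

theorem eq_zero_of_lp {x : Vec n} (h : ∀ z, lp x z = 0) : x = 0 := by
  rw [← lorentz_mulVec_mulVec x]
  have : (lorentz n).mulVec x = 0 := by
    apply dotProduct_eq_zero
    intro w
    rw [← bil_eq_mulVec_dotProduct lorentz_isSymm]
    exact h w
  rw [this, Matrix.mulVec_zero]

/-- `h` is a unit normal vector of the hyperplane `W`. -/
structure IsUnitNormal (h : Vec n) (W : Submodule ℝ (Vec n)) : Prop where
  unit : lp h h = 1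
  mem_iff : ∀ w, w ∈ W ↔ lp h w = 0

/-- The plane contains a hyperbolic pair, so a normal is spacelike and can be scaled to length one.
-/
theorem exists_isUnitNormal {W : Submodule ℝ (Vec 2)} (hW : Module.finrank ℝ W = 3)
    {x y : Vec 2} (hx : x ∈ W) (hy : y ∈ W) (hxx : lp x x = 0) (hxy : lp x y ≠ 0) :
    ∃ h, IsUnitNormal h W := by
  have h4 : Module.finrank ℝ (Vec 2) = 4 := by simp
  have hlt : W < ⊤ := by
    rw [lt_top_iff_ne_top]
    rintro rfl
    rw [finrank_top, h4] at hW
    omega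
  obtain ⟨f, hf, hWf⟩ := Submodule.exists_le_ker_of_lt_top W hlt
  have hker : W = LinearMap.ker f := by
    apply Submodule.eq_of_le_of_finrank_le hWf
    have h1 := f.finrank_range_add_finrank_ker
    have h2 : 0 < Module.finrank ℝ (LinearMap.range f) := by
      rw [Nat.pos_iff_ne_zero, Ne, Submodule.finrank_eq_zero, LinearMap.range_eq_bot]
      exact hf
    rw [h4] at h1
    omega
  let c : Vec 2 := fun k => f (Pi.single k 1)
  have hfc : ∀ w, f w = dotProduct c w := fun w => by
    conv_lhs => rw [← Finset.univ_sum_single w]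
    rw [map_sum, dotProduct]
    refine Finset.sum_congr rfl fun k _ => ?_
    rw [show Pi.single k (w k) = w k • (Pi.single k 1 : Vec 2) by
      rw [← Pi.single_smul, smul_eq_mul, mul_one], map_smul, smul_eq_mul, mul_comm]
  let g := (lorentz 2).mulVec c
  have hg : ∀ w, lp g w = f w := fun w => by
    rw [lp, bil_eq_mulVec_dotProduct lorentz_isSymm, lorentz_mulVec_mulVec, hfc]
  have hmem : ∀ w, w ∈ W ↔ lp g w = 0 := fun w => by rw [hg, hker, LinearMap.mem_ker]
  have hg0 : g ≠ 0 := by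
    intro h0
    apply hf
    refine LinearMap.ext fun w => ?_
    rw [← hg, h0]
    exact bil_zero_left _ _
  have hpos := lp_self_pos_of_orthogonal_pair hxx hxy ((hmem x).mp hx) ((hmem y).mp hy) hg0
  have hs := Real.sqrt_pos.mpr hpos
  refine ⟨(Real.sqrt (lp g g))⁻¹ • g, ?_, fun w => ?_⟩
  · rw [lp_smul_left, lp_smul_right]
    have := Real.mul_self_sqrt hpos.le
    field_simp
    linarith
  · rw [hmem, lp_smul_left]
    simp [hs.ne']

/-- The products of a vector with three given vectors. -/
def lpTriple (a b c : Vec n) : Vec n →ₗ[ℝ] Fin 3 → ℝ where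
  toFun x := ![lp a x, lp b x, lp c x]
  map_add' x y := by simp only [lp_add_right]; ext i; fin_cases i <;> rfl
  map_smul' t x := by simp only [lp_smul_right]; ext i; fin_cases i <;> rfl

theorem mem_ker_lpTriple {a b c x : Vec n} :
    x ∈ LinearMap.ker (lpTriple a b c) ↔ lp a x = 0 ∧ lp b x = 0 ∧ lp c x = 0 := by
  rw [LinearMap.mem_ker]
  constructor
  · intro hx
    exact ⟨congrFun hx 0, congrFun hx 1, congrFun hx 2⟩
  · rintro ⟨h1, h2, h3⟩
    ext i
    fin_cases i <;> assumption

theorem lpTriple_surjective {a b c : Vec n}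
    (h : ∀ r s t : ℝ, r • a + s • b + t • c = 0 → r = 0 ∧ s = 0 ∧ t = 0) :
    Function.Surjective (lpTriple a b c) := by
  rw [← LinearMap.range_eq_top]
  by_contra hne
  obtain ⟨f, hf, hle⟩ := Submodule.exists_le_ker_of_lt_top _ (lt_top_iff_ne_top.mpr hne)
  have hfe : ∀ y, f y = f ![1, 0, 0] * y 0 + f ![0, 1, 0] * y 1 + f ![0, 0, 1] * y 2 := fun y => by
    have : y = y 0 • ![1, 0, 0] + y 1 • ![0, 1, 0] + y 2 • ![0, 0, 1] := by
      ext i; fin_cases i <;> simp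
    conv_lhs => rw [this]
    simp only [map_add, map_smul, smul_eq_mul]
    ring
  obtain ⟨h1, h2, h3⟩ := h (f ![1, 0, 0]) (f ![0, 1, 0]) (f ![0, 0, 1]) (by
    apply eq_zero_of_lp
    intro z
    have hz : f (lpTriple a b c z) = 0 := hle ⟨z, rfl⟩
    rw [hfe] at hz
    rw [lp_add_left, lp_add_left, lp_smul_left, lp_smul_left, lp_smul_left]
    exact hz)
  apply hf
  refine LinearMap.ext fun y => ?_
  rw [hfe, h1, h2, h3]
  simp

/-- Three planes without a common line have independent normals. -/
theorem coeff_eq_zero_of_normals {h₁ h₂ h₃ : Vec 2} {W₁ W₂ W₃ : Submodule ℝ (Vec 2)}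
    (H₁ : IsUnitNormal h₁ W₁) (H₂ : IsUnitNormal h₂ W₂) (H₃ : IsUnitNormal h₃ W₃)
    (hW : Module.finrank ℝ (W₁ ⊓ W₂ ⊓ W₃ : Submodule ℝ (Vec 2)) ≤ 1) {a b c : ℝ}
    (e : a • h₁ + b • h₂ + c • h₃ = 0) : a = 0 ∧ b = 0 ∧ c = 0 := by
  have hker : LinearMap.ker (lpTriple h₁ h₂ h₃) = W₁ ⊓ W₂ ⊓ W₃ := by
    ext x
    rw [mem_ker_lpTriple, Submodule.mem_inf, Submodule.mem_inf, H₁.mem_iff, H₂.mem_iff,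
      H₃.mem_iff, and_assoc]
  have hr := (lpTriple h₁ h₂ h₃).finrank_range_add_finrank_ker
  rw [hker, show Module.finrank ℝ (Vec 2) = 4 by simp] at hr
  have hsurj : Function.Surjective (lpTriple h₁ h₂ h₃) := by
    rw [← LinearMap.range_eq_top]
    apply Submodule.eq_top_of_finrank_eq
    have := Submodule.finrank_le (LinearMap.range (lpTriple h₁ h₂ h₃))
    rw [Module.finrank_fin_fun] at *
    omega
  have key : ∀ y : Fin 3 → ℝ, a * y 0 + b * y 1 + c * y 2 = 0 := fun y => by
    obtain ⟨x, rfl⟩ := hsurj y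
    change a * lp h₁ x + b * lp h₂ x + c * lp h₃ x = 0
    rw [← lp_smul_left, ← lp_smul_left, ← lp_smul_left, ← lp_add_left, ← lp_add_left, e]
    exact bil_zero_left _ _
  refine ⟨?_, ?_, ?_⟩
  · simpa using key ![1, 0, 0]
  · simpa using key ![0, 1, 0]
  · simpa using key ![0, 0, 1]

/-- The orthogonal complement of three independent vectors is one-dimensional. -/
theorem eq_smul_of_orthogonal_triple {a b c x k : Vec 2}
    (h : ∀ r s t : ℝ, r • a + s • b + t • c = 0 → r = 0 ∧ s = 0 ∧ t = 0) (hk : k ≠ 0)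
    (ka : lp a k = 0) (kb : lp b k = 0) (kc : lp c k = 0)
    (xa : lp a x = 0) (xb : lp b x = 0) (xc : lp c x = 0) : ∃ t : ℝ, x = t • k := by
  have hr := (lpTriple a b c).finrank_range_add_finrank_ker
  rw [LinearMap.range_eq_top.mpr (lpTriple_surjective h), finrank_top, Module.finrank_fin_fun,
    show Module.finrank ℝ (Vec 2) = 4 by simp] at hr
  have h1 : Module.finrank ℝ (LinearMap.ker (lpTriple a b c)) = 1 := by omega
  have := (finrank_eq_one_iff_of_nonzero'
    (⟨k, mem_ker_lpTriple.mpr ⟨ka, kb, kc⟩⟩ : LinearMap.ker (lpTriple a b c))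
    (fun e => hk (congrArg Subtype.val e))).mp h1 ⟨x, mem_ker_lpTriple.mpr ⟨xa, xb, xc⟩⟩
  obtain ⟨t, ht⟩ := this
  exact ⟨t, (congrArg Subtype.val ht).symm⟩

/-- Three independent vectors orthogonal to `k` span the hyperplane orthogonal to `k`. -/
theorem exists_coeff_of_orthogonal {a b c x k : Vec 2}
    (h : ∀ r s t : ℝ, r • a + s • b + t • c = 0 → r = 0 ∧ s = 0 ∧ t = 0) (hk : k ≠ 0)
    (ka : lp k a = 0) (kb : lp k b = 0) (kc : lp k c = 0) (kx : lp k x = 0) :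
    ∃ r s t : ℝ, x = r • a + s • b + t • c := by
  let φ : Vec 2 →ₗ[ℝ] ℝ :=
    { toFun := fun y => lp k y
      map_add' := lp_add_right k
      map_smul' := fun t y => lp_smul_right t k y }
  have hr : Module.finrank ℝ (LinearMap.ker φ) = 3 := by
    have h1 := φ.finrank_range_add_finrank_ker
    have h2 : Module.finrank ℝ (LinearMap.range φ) ≠ 0 := by
      rw [Ne, Submodule.finrank_eq_zero, LinearMap.range_eq_bot]
      intro h0
      exact hk (eq_zero_of_lp fun z => congrArg (fun f : Vec 2 →ₗ[ℝ] ℝ => f z) h0)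
    have h3 := Submodule.finrank_le (LinearMap.range φ)
    rw [Module.finrank_self] at h3
    rw [show Module.finrank ℝ (Vec 2) = 4 by simp] at h1
    omega
  exact exists_coeff_of_mem hr (linearIndependent_of_coeff h) ka kb kc kx

/-- Any three vectors of the family are independent. -/
def NormalsIndependent (h : ℤ → Vec n) : Prop :=
  ∀ i k l, i ≠ k → k ≠ l → i ≠ l → ∀ a b c : ℝ, a • h i + b • h k + c • h l = 0 →
    a = 0 ∧ b = 0 ∧ c = 0

theorem GeneralPosition.normalsIndependent {W : ℤ → Submodule ℝ (Vec 2)} (hW : GeneralPosition W)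
    {h : ℤ → Vec 2} (hh : ∀ i, IsUnitNormal (h i) (W i)) : NormalsIndependent h :=
  fun i k l h1 h2 h3 _ _ _ e =>
    coeff_eq_zero_of_normals (hh i) (hh k) (hh l) (hW.not_coaxial i k l h1 h2 h3) e

theorem NormalsIndependent.ne_smul {h : ℤ → Vec n} (hh : NormalsIndependent h) {i k : ℤ}
    (hik : i ≠ k) (c : ℝ) : h i ≠ c • h k := by
  intro e
  obtain ⟨l, hl1, hl2⟩ : ∃ l : ℤ, l ≠ i ∧ l ≠ k := by
    obtain ⟨l, hl⟩ := Infinite.exists_notMem_finset ({i, k} : Finset ℤ)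
    simp only [Finset.mem_insert, Finset.mem_singleton, not_or] at hl
    exact ⟨l, hl⟩
  have := hh i k l hik hl2.symm hl1.symm 1 (-c) 0 (by rw [e]; module)
  exact one_ne_zero this.1

end Normals

/-! ### Angle relations between the two families of normals -/

section StripData

variable {m : ℤ → ℤ → Vec 2} {h : ℤ → Vec 2} {H : ℤ → Submodule ℝ (Vec 2)}

theorem eq_smul_of_le {h h' : Vec 2} {W : Submodule ℝ (Vec 2)} (hW : IsUnitNormal h W)
    (hw : ∀ w ∈ W, lp h' w = 0) : ∃ c : ℝ, h' = c • h := by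
  refine ⟨lp h' h, ?_⟩
  rw [← sub_eq_zero]
  apply eq_zero_of_lp
  intro z
  have := hw (z - lp h z • h) (by
    rw [hW.mem_iff, lp_sub_right, lp_smul_right, hW.unit]; ring)
  rw [lp_sub_right, lp_smul_right] at this
  rw [lp_sub_left, lp_smul_left]
  linarith

/-- If all vertices of a parameter line propagate the incidence with a hyperplane, the normals are
proportional. -/
theorem NullNet.eq_smul_of_incident (hm : NullNet m) {j : ℤ} (hH : Module.finrank ℝ (H j) = 3)
    (hmH : ∀ i, m i j ∈ H j) (hh : IsUnitNormal (h j) (H j)) {g : Vec 2}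
    (hstep : ∀ i, lp g (m i j) = 0 → lp g (m (i + 1) j) = 0) {i : ℤ} (hi : lp g (m i j) = 0) :
    ∃ c : ℝ, g = c • h j := by
  apply eq_smul_of_le hh
  intro w hw
  obtain ⟨a, b, c, rfl⟩ := hm.exists_coeff_fst hH i j hmH hw
  have h1 := hstep _ hi
  have h2 := hstep _ h1
  rw [add_assoc] at h2
  norm_num at h2
  simp only [lp_add_right, lp_smul_right, hi, h1, h2, mul_zero, add_zero]

/-- If one vertex also lay in the plane of the neighbouring circle, the quad relations would pass
this on to the following vertices, and the two planes would coincide. -/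
theorem NullNet.lp_succ_ne_zero (hm : NullNet m) (hH : ∀ j, Module.finrank ℝ (H j) = 3)
    (hmH : ∀ i j, m i j ∈ H j) (hh : ∀ j, IsUnitNormal (h j) (H j)) (hi : NormalsIndependent h)
    (i j : ℤ) : lp (h (j + 1)) (m i j) ≠ 0 ∧ lp (h j) (m i (j + 1)) ≠ 0 := by
  have o : ∀ i j, lp (h j) (m i j) = 0 := fun i j => ((hh j).mem_iff _).mp (hmH i j)
  constructor
  · intro e
    obtain ⟨c, hc⟩ := hm.eq_smul_of_incident (hH j) (fun i => hmH i j) (hh j)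
      (g := h (j + 1)) (fun i hi => by
        obtain ⟨a, b, c, d, ha, hb, hc, hd, e⟩ := hm.quad i j
        have := congrArg (lp (h (j + 1))) e
        simp only [lp_add_right, lp_smul_right, hi, o, mul_zero, add_zero, zero_add] at this
        rw [show lp (h (j + 1)) 0 = 0 from bil_zero_right _ _] at this
        simpa [hb] using this) e
    exact hi.ne_smul (by simp) c hc
  · intro e
    obtain ⟨c, hc⟩ := hm.eq_smul_of_incident (hH (j + 1)) (fun i => hmH i (j + 1)) (hh (j + 1))
      (g := h j) (fun i hi => by
        obtain ⟨a, b, c, d, ha, hb, hc, hd, e⟩ := hm.quad i j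
        have := congrArg (lp (h j)) e
        simp only [lp_add_right, lp_smul_right, hi, o, mul_zero, add_zero, zero_add] at this
        rw [show lp (h j) 0 = 0 from bil_zero_right _ _] at this
        simpa [hd] using this) e
    exact hi.ne_smul (by simp) c hc

/-- Constants `s j`, `r j` of a family of unit vectors `h j` and a family of unit vectors `v i`
whose angles with successive vectors of the first family differ by fixed angles with cosine `s j`
and sine `r j`. -/
structure StripData (h v : ℤ → Vec 2) (s r : ℤ → ℝ) : Prop where
  sq_add : ∀ j, r j ^ 2 = 1 - s j ^ 2
  ne_zero : ∀ j, r j ≠ 0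
  ne_lp : ∀ j, s j ≠ lp (h j) (h (j + 1))
  angle : ∀ i j, ∃ w, lp (h j) (v i) - s j * lp (h (j + 1)) (v i) = r j * w ∧
    lp (h (j + 2)) (v i) - s (j + 1) * lp (h (j + 1)) (v i) = r (j + 1) * w ∧
    w ^ 2 = 1 - lp (h (j + 1)) (v i) ^ 2

theorem NullNet.stripData (hm : NullNet m) {V : ℤ → Submodule ℝ (Vec 2)} {v : ℤ → Vec 2}
    (hH : ∀ j, Module.finrank ℝ (H j) = 3)
    (hmH : ∀ i j, m i j ∈ H j) (hmV : ∀ i j, m i j ∈ V i)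
    (hh : ∀ j, IsUnitNormal (h j) (H j)) (hv : ∀ i, IsUnitNormal (v i) (V i))
    (hi : NormalsIndependent h)
    (hconc : ∀ j (T : Vec 2), (∀ i, ∃ a b : ℝ, T = a • m i j + b • m i (j + 1)) → T = 0) :
    ∃ s r : ℤ → ℝ, StripData h v s r := by
  have o : ∀ i j, lp (h j) (m i j) = 0 := fun i j => ((hh j).mem_iff _).mp (hmH i j)
  have ov : ∀ i j, lp (v i) (m i j) = 0 := fun i j => ((hv i).mem_iff _).mp (hmV i j)
  let C (i j : ℤ) : ℝ := edgeCos (m i j) (m i (j + 1)) (h j) (h (j + 1))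
  let S (i j : ℤ) : ℝ := edgeSin (m i j) (m i (j + 1)) (h j) (h (j + 1))
  have next : ∀ i j, C (i + 1) j = C i j ∧ S (i + 1) j = -S i j := fun i j => by
    obtain ⟨a, b, c, d, ha, hb, hc, hd, e⟩ := hm.quad i j
    exact edge_next (hm.null _ _) (hm.null _ _) (hm.null _ _) (hm.null _ _) (hm.fst _ _)
      (o _ _) (o _ _) (o _ _) (o _ _) ha hb hc hd e
  have hC : ∀ i j, C i j = C 0 j := fun i j => by
    induction i using Int.induction_on with
    | zero => rfl
    | succ k ih => rw [(next _ _).1, ih]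
    | pred k ih => rw [← ih, ← (next (-(k : ℤ) - 1) j).1, sub_add_cancel]
  -- The sign depends on `i` only and is common to all strips; this is what lets two successive
  -- strips share the same `w`.
  have hS : ∀ i, ∃ ε : ℝ, ∀ j, S i j = ε * S 0 j := fun i => by
    induction i using Int.induction_on with
    | zero => exact ⟨1, fun j => by rw [one_mul]⟩
    | succ k ih =>
      obtain ⟨ε, hε⟩ := ih
      exact ⟨-ε, fun j => by rw [(next _ _).2, hε, neg_mul]⟩
    | pred k ih =>
      obtain ⟨ε, hε⟩ := ih
      refine ⟨-ε, fun j => ?_⟩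
      have := (next (-(k : ℤ) - 1) j).2
      rw [sub_add_cancel] at this
      linarith [hε j]
  have hsq : ∀ i j, S i j ^ 2 = 1 - C i j ^ 2 := fun i j =>
    edge_sq (hm.null _ _) (hm.null _ _) (hm.snd _ _) (o _ _) (o _ _) (hh _).unit (hh _).unit
  -- With sine zero, all edges of the strip would pass through the point of `h j - C 0 j • h (j +
  -- 1)`, against non-concurrency.
  have hS0 : ∀ j, S 0 j ≠ 0 := fun j e => by
    have h1 : C 0 j ^ 2 = 1 := by
      have := hsq 0 j
      rw [e] at this
      linarith
    have := hconc j (h j - C 0 j • h (j + 1)) fun i => by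
      rw [← hC i j] at h1 ⊢
      exact sub_smul_eq_of_edgeCos_sq (hm.null _ _) (hm.null _ _) (hm.snd _ _) (o _ _) (o _ _)
        (hh _).unit (hh _).unit h1
    exact hi.ne_smul (by simp) _ (sub_eq_zero.mp this)
  refine ⟨C 0, S 0, hsq 0, hS0, fun j => ?_, fun i j => ?_⟩
  · have hne := hm.lp_succ_ne_zero hH hmH hh hi 0 j
    have : lp (h (j + 1)) (m 0 j) * lp (h j) (m 0 (j + 1)) / lp (m 0 j) (m 0 (j + 1)) ≠ 0 :=
      div_ne_zero (mul_ne_zero hne.1 hne.2) (hm.snd _ _)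
    intro e
    apply this
    simp only [C, edgeCos] at e
    linarith
  · obtain ⟨ε, hε⟩ := hS i
    have hε2 : ε ^ 2 = 1 := by
      have h1 := hsq i j
      have h2 := hsq 0 j
      rw [hC, ← h2, hε] at h1
      apply mul_right_cancel₀ (pow_ne_zero 2 (hS0 j))
      linarith
    have hn : m i (j + 1) ≠ 0 := by
      intro h0
      apply hm.snd i j
      rw [h0]
      exact bil_zero_right _ _
    have hmm : lp (m i (j + 2)) (m i (j + 1)) ≠ 0 := by
      rw [lp_comm]
      have := hm.snd i (j + 1)
      rwa [add_assoc] at this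
    have e1 := lp_sub_edgeCos_mul (hm.null i j) (hm.null i (j + 1)) (hm.snd i j) (o i j)
      (o i (j + 1)) (hh (j + 1)).unit (ov i j) (ov i (j + 1))
    have e2 := lp_sub_edgeCos_mul (hm.null i (j + 2)) (hm.null i (j + 1)) hmm (o i (j + 2))
      (o i (j + 1)) (hh (j + 1)).unit (ov i (j + 2)) (ov i (j + 1))
    have e3 := vol_div_sq (hm.null i j) (hm.null i (j + 1)) (hm.snd i j)
      (o i (j + 1)) (hh (j + 1)).unit (ov i j) (ov i (j + 1))
    -- The edges below and above `m i (j + 1)` see `V i` and `H (j + 1)` under the same oriented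
    -- angle.
    rw [vol_div_eq (hm.null _ _) hn (hm.snd i j) hmm (o _ _) (ov _ _), edgeCos_swap,
      edgeSin_swap] at e2
    have d1 : C i (j + 1) = edgeCos (m i (j + 1)) (m i (j + 2)) (h (j + 1)) (h (j + 2)) := by
      simp only [C, add_assoc]; norm_num
    have d2 : S i (j + 1) = edgeSin (m i (j + 1)) (m i (j + 2)) (h (j + 1)) (h (j + 2)) := by
      simp only [S, add_assoc]; norm_num
    rw [← d1, ← d2, hC, hε] at e2
    change lp (h j) (v i) - C i j * _ = S i j * _ at e1
    rw [hC, hε] at e1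
    rw [(hv i).unit] at e3
    refine ⟨ε * (vol (m i j) (m i (j + 1)) (h (j + 1)) (v i) / lp (m i j) (m i (j + 1))),
      by rw [e1]; ring, by rw [e2]; ring, ?_⟩
    rw [mul_pow, hε2, one_mul, e3]

end StripData

/-! ### Five points on a conic -/

section FivePoints

/-- Five points of a plane, no three of them collinear, on a conic: if two of them are conjugate,
they are conjugate to the third one as well. -/
theorem conjugate_of_five_points {B : Vec 2 → Vec 2 → ℝ} (Bc : ∀ p q, B p q = B q p)
    (Bl : ∀ r t u p q q' w, B (r • p + t • q + u • q') w = r * B p w + t * B q w + u * B q' w)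
    {k : Vec 2} (hk : k ≠ 0) {p : Fin 5 → Vec 2} (hp : ∀ i, lp k (p i) = 0)
    (hB : ∀ i, B (p i) (p i) = 0)
    (hi : ∀ a b c, a ≠ b → b ≠ c → a ≠ c → ∀ r s t : ℝ, r • p a + s • p b + t • p c = 0 →
      r = 0 ∧ s = 0 ∧ t = 0) (h01 : B (p 0) (p 1) = 0) :
    B (p 0) (p 2) = 0 ∧ B (p 1) (p 2) = 0 := by
  have ind := hi 0 1 2 (by decide) (by decide) (by decide)
  obtain ⟨x, y, z, e3⟩ := exists_coeff_of_orthogonal ind hk (hp 0) (hp 1) (hp 2) (hp 3)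
  obtain ⟨x', y', z', e4⟩ := exists_coeff_of_orthogonal ind hk (hp 0) (hp 1) (hp 2) (hp 4)
  -- The conic contains the line through `p 0` and `p 1`, so its equation splits. The other three
  -- points are off that line; unless the second factor vanishes identically, they are collinear.
  have quad : ∀ x y z, B (x • p 0 + y • p 1 + z • p 2) (x • p 0 + y • p 1 + z • p 2) =
      2 * z * (x * B (p 0) (p 2) + y * B (p 1) (p 2)) := fun x y z => by
    rw [Bl, Bc _ (_ + _), Bc _ (_ + _), Bc _ (_ + _), Bl, Bl, Bl, Bc (p 1) (p 0),
      Bc (p 2) (p 0), Bc (p 2) (p 1)]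
    simp only [hB, h01]
    ring
  have hz : z ≠ 0 := by
    rintro rfl
    have := hi 0 1 3 (by decide) (by decide) (by decide) x y (-1) (by rw [e3]; module)
    exact absurd this.2.2 (by norm_num)
  have hz' : z' ≠ 0 := by
    rintro rfl
    have := hi 0 1 4 (by decide) (by decide) (by decide) x' y' (-1) (by rw [e4]; module)
    exact absurd this.2.2 (by norm_num)
  have hx' : x' ≠ 0 := by
    rintro rfl
    have := hi 1 2 4 (by decide) (by decide) (by decide) y' z' (-1) (by rw [e4]; module)
    exact absurd this.2.2 (by norm_num)
  have q3 : x * B (p 0) (p 2) + y * B (p 1) (p 2) = 0 := by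
    have := quad x y z
    rw [← e3, hB] at this
    simpa [hz] using this.symm
  have q4 : x' * B (p 0) (p 2) + y' * B (p 1) (p 2) = 0 := by
    have := quad x' y' z'
    rw [← e4, hB] at this
    simpa [hz'] using this.symm
  have h12 : B (p 1) (p 2) = 0 := by
    by_contra h12
    have hdet : x' * y = x * y' := by
      apply mul_left_cancel₀ h12
      linear_combination x' * q3 - x * q4
    have := hi 3 4 2 (by decide) (by decide) (by decide) x' (-x) (x * z' - x' * z) (by
      rw [e3, e4]
      linear_combination (norm := module) hdet • p 1)
    exact hx' this.1
  rw [h12, mul_zero, add_zero] at q4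
  exact ⟨(mul_eq_zero.mp q4).resolve_left hx', h12⟩

end FivePoints

/-! ### The quadric of a strip, its dual and its tangent cone -/

section Cone

/-- The operator of the quadric that contains the circles with unit normals `h`, `h'`. -/
noncomputable def ruledOp (h h' : Vec 2) (s : ℝ) (x : Vec 2) : Vec 2 :=
  x + (s - lp h h')⁻¹ • (lp h' x • h + lp h x • h')

/-- The operator of the dual of the quadric of `ruledOp`. -/
noncomputable def ruledDual (h h' : Vec 2) (s : ℝ) (x : Vec 2) : Vec 2 :=
  x - (1 - s ^ 2)⁻¹ • ((lp h x - s * lp h' x) • h + (lp h' x - s * lp h x) • h')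

variable {h h' : Vec 2} {s : ℝ}

theorem lp_ruledOp (x y : Vec 2) : lp (ruledOp h h' s x) y = lp x (ruledOp h h' s y) := by
  simp only [ruledOp, lp_add_left, lp_add_right, lp_smul_left, lp_smul_right, lp_comm x h,
    lp_comm x h']
  ring

theorem lp_ruledDual (x y : Vec 2) : lp (ruledDual h h' s x) y = lp x (ruledDual h h' s y) := by
  simp only [ruledDual, lp_sub_left, lp_sub_right, lp_add_left, lp_add_right, lp_smul_left,
    lp_smul_right, lp_comm x h, lp_comm x h']
  ring

theorem ruledOp_smul (c : ℝ) (x : Vec 2) : ruledOp h h' s (c • x) = c • ruledOp h h' s x := by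
  simp only [ruledOp, lp_smul_right]
  module

theorem ruledOp_ruledDual (hu : lp h h = 1) (hu' : lp h' h' = 1) (hs : 1 - s ^ 2 ≠ 0)
    (hne : s ≠ lp h h') (x : Vec 2) : ruledOp h h' s (ruledDual h h' s x) = x := by
  have ht : s - lp h h' ≠ 0 := sub_ne_zero.mpr hne
  rw [ruledOp]
  simp only [ruledDual, lp_sub_right, lp_add_right, lp_smul_right, hu, hu', lp_comm h' h]
  set X := lp h x
  set Y := lp h' x
  set b := lp h h'
  have c1 : (s - b)⁻¹ * (Y - (1 - s ^ 2)⁻¹ * ((X - s * Y) * b + (Y - s * X) * 1))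
      = (1 - s ^ 2)⁻¹ * (X - s * Y) := by
    field_simp
    ring
  have c2 : (s - b)⁻¹ * (X - (1 - s ^ 2)⁻¹ * ((X - s * Y) * 1 + (Y - s * X) * b))
      = (1 - s ^ 2)⁻¹ * (Y - s * X) := by
    field_simp
    ring
  linear_combination (norm := module) c1 • h + c2 • h'

theorem ruledDual_ruledOp (hu : lp h h = 1) (hu' : lp h' h' = 1) (hs : 1 - s ^ 2 ≠ 0)
    (hne : s ≠ lp h h') (x : Vec 2) : ruledDual h h' s (ruledOp h h' s x) = x := by
  have ht : s - lp h h' ≠ 0 := sub_ne_zero.mpr hne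
  rw [ruledDual]
  simp only [ruledOp, lp_add_right, lp_smul_right, hu, hu', lp_comm h' h]
  set X := lp h x
  set Y := lp h' x
  set b := lp h h'
  have c1 : (1 - s ^ 2)⁻¹ * (X + (s - b)⁻¹ * (Y * 1 + X * b) -
      s * (Y + (s - b)⁻¹ * (Y * b + X * 1))) = (s - b)⁻¹ * Y := by
    field_simp
    ring
  have c2 : (1 - s ^ 2)⁻¹ * (Y + (s - b)⁻¹ * (Y * b + X * 1) -
      s * (X + (s - b)⁻¹ * (Y * 1 + X * b))) = (s - b)⁻¹ * X := by
    field_simp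
    ring
  linear_combination (norm := module) -(c1 • h) - c2 • h'

/-- Orthogonalising against `h'` exposes the combinations occurring in `StripData.angle`: at `x = v
i` the quadratic form becomes 1 minus the squares of a cosine and a sine. -/
theorem ruledDual_eq {r : ℝ} (hr : r ≠ 0) (hs : r ^ 2 = 1 - s ^ 2) (x : Vec 2) :
    ruledDual h h' s x =
      x - lp h' x • h' - ((r ^ 2)⁻¹ * (lp h x - s * lp h' x)) • (h - s • h') := by
  rw [ruledDual, ← hs]
  have c : (r ^ 2)⁻¹ * (lp h' x - s * lp h x) =
      lp h' x - s * ((r ^ 2)⁻¹ * (lp h x - s * lp h' x)) := by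
    field_simp
    linear_combination (- lp h' x) * hs
  rw [smul_add, smul_smul, smul_smul, c]
  module

theorem ruledDual_swap (x : Vec 2) : ruledDual h' h s x = ruledDual h h' s x := by
  rw [ruledDual, ruledDual, add_comm (_ • h')]

/-- The Gram matrix of the cone with apex `k` that is tangent to the quadric of `ruledOp`. -/
noncomputable def tangentCone (h h' : Vec 2) (s : ℝ) (k : Vec 2) : Form 2 :=
  lorentz 2 + (s - lp h h')⁻¹ •
    (Matrix.vecMulVec ((lorentz 2).mulVec h) ((lorentz 2).mulVec h') +
      Matrix.vecMulVec ((lorentz 2).mulVec h') ((lorentz 2).mulVec h)) -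
    (lp k (ruledOp h h' s k))⁻¹ •
      Matrix.vecMulVec ((lorentz 2).mulVec (ruledOp h h' s k))
        ((lorentz 2).mulVec (ruledOp h h' s k))

theorem tangentCone_isSymm (k : Vec 2) : (tangentCone h h' s k).IsSymm := by
  rw [Matrix.IsSymm, tangentCone]
  simp only [Matrix.transpose_sub, Matrix.transpose_add, Matrix.transpose_smul,
    Matrix.transpose_vecMulVec, lorentz_isSymm.eq]
  rw [add_comm (Matrix.vecMulVec _ _)]

theorem tangentCone_mulVec (k x : Vec 2) : (tangentCone h h' s k).mulVec x =
    (lorentz 2).mulVec (ruledOp h h' s x -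
      ((lp k (ruledOp h h' s k))⁻¹ * lp k (ruledOp h h' s x)) • ruledOp h h' s k) := by
  have e : ∀ a b : Vec 2, (Matrix.vecMulVec ((lorentz 2).mulVec a) ((lorentz 2).mulVec b)).mulVec x
      = lp b x • (lorentz 2).mulVec a := fun a b => by
    rw [Matrix.vecMulVec_mulVec, ← bil_eq_mulVec_dotProduct lorentz_isSymm]
    simp
  rw [tangentCone, Matrix.sub_mulVec, Matrix.add_mulVec, Matrix.smul_mulVec, Matrix.smul_mulVec,
    Matrix.add_mulVec, e, e, e, lp_ruledOp, Matrix.mulVec_sub, Matrix.mulVec_smul]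
  conv_rhs => enter [1]; rw [ruledOp]
  rw [Matrix.mulVec_add, Matrix.mulVec_smul, Matrix.mulVec_add, Matrix.mulVec_smul,
    Matrix.mulVec_smul, smul_smul]

end Cone

/-! ### The common apex and the two cones -/

section Family

variable {h v : ℤ → Vec 2} {s r : ℤ → ℝ}

/-- The common point of the planes with normals `v i`, computed from three successive vectors
`h j`. -/
def apex (h : ℤ → Vec 2) (s r : ℤ → ℝ) (j : ℤ) : Vec 2 :=
  r (j + 1) • (h j - s j • h (j + 1)) - r j • (h (j + 2) - s (j + 1) • h (j + 1))

/-- Eliminating `w` from the two linear angle relations leaves an equation linear in `v i`, with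
coefficient vector `apex h s r j`. -/
theorem StripData.lp_apex (hd : StripData h v s r) (i j : ℤ) : lp (apex h s r j) (v i) = 0 := by
  obtain ⟨w, h1, h2, -⟩ := hd.angle i j
  simp only [apex, lp_sub_left, lp_smul_left]
  linear_combination r (j + 1) * h1 - r j * h2

theorem StripData.apex_notMem (hd : StripData h v s r) (hh : NormalsIndependent h) (j : ℤ)
    (a b : ℝ) : apex h s r j ≠ a • h j + b • h (j + 1) := by
  intro e
  have := hh j (j + 1) (j + 2) (by simp) (by simp) (by simp) (r (j + 1) - a)
    (- (r (j + 1) * s j) + r j * s (j + 1) - b) (- r j) (by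
      rw [← sub_eq_zero.mpr e, apex]; module)
  exact hd.ne_zero j (neg_eq_zero.mp this.2.2)

theorem StripData.apex_ne_zero (hd : StripData h v s r) (hh : NormalsIndependent h) (j : ℤ) :
    apex h s r j ≠ 0 := by
  have := hd.apex_notMem hh j 0 0
  rwa [zero_smul, zero_smul, add_zero] at this

theorem StripData.apex_eq_smul (hd : StripData h v s r) (hh : NormalsIndependent h)
    (hv : NormalsIndependent v) (j : ℤ) : ∃ c : ℝ, c ≠ 0 ∧ apex h s r j = c • apex h s r 0 := by
  obtain ⟨c, hc⟩ := eq_smul_of_orthogonal_triple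
    (fun a b c => hv 0 1 2 (by decide) (by decide) (by decide) a b c)
    (hd.apex_ne_zero hh 0) (x := apex h s r j)
    (by rw [lp_comm]; exact hd.lp_apex _ _) (by rw [lp_comm]; exact hd.lp_apex _ _)
    (by rw [lp_comm]; exact hd.lp_apex _ _) (by rw [lp_comm]; exact hd.lp_apex _ _)
    (by rw [lp_comm]; exact hd.lp_apex _ _) (by rw [lp_comm]; exact hd.lp_apex _ _)
  refine ⟨c, ?_, hc⟩
  rintro rfl
  exact hd.apex_ne_zero hh j (by rw [hc, zero_smul])

/-- The dual quadrics of successive strips coincide on the polar plane of the apex. -/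
theorem StripData.ruledDual_succ (hd : StripData h v s r) (j : ℤ) {x : Vec 2}
    (hx : lp (apex h s r j) x = 0) : ∃ c : ℝ,
    ruledDual (h (j + 1)) (h (j + 2)) (s (j + 1)) x =
      ruledDual (h j) (h (j + 1)) (s j) x + c • apex h s r j := by
  have h0 := hd.ne_zero j
  have h1 := hd.ne_zero (j + 1)
  rw [← ruledDual_swap (h := h (j + 1)), ruledDual_eq h1 (hd.sq_add _),
    ruledDual_eq h0 (hd.sq_add _)]
  simp only [apex, lp_sub_left, lp_smul_left] at hx
  set X := lp (h j) x - s j * lp (h (j + 1)) x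
  set Z := lp (h (j + 2)) x - s (j + 1) * lp (h (j + 1)) x
  have hZ : Z = r (j + 1) * X / r j := by
    field_simp
    linarith
  -- The two operators differ only in their last rank-one terms. As `x` is orthogonal to the apex,
  -- `Z` and `X` are proportional, and the terms combine to this multiple of the apex.
  refine ⟨X / (r j ^ 2 * r (j + 1)), ?_⟩
  rw [hZ, apex]
  have c1 : (r (j + 1) ^ 2)⁻¹ * (r (j + 1) * X / r j) =
      X / (r j ^ 2 * r (j + 1)) * r j := by field_simp
  have c2 : (r j ^ 2)⁻¹ * X = X / (r j ^ 2 * r (j + 1)) * r (j + 1) := by field_simp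
  rw [c1, c2]
  module

theorem StripData.ruledDual_sub (hd : StripData h v s r) (hh : NormalsIndependent h)
    (hv : NormalsIndependent v) {x : Vec 2} (hx : lp (apex h s r 0) x = 0) (j : ℤ) : ∃ c : ℝ,
    ruledDual (h j) (h (j + 1)) (s j) x =
      ruledDual (h 0) (h 1) (s 0) x + c • apex h s r 0 := by
  have step : ∀ j, ∃ c : ℝ, ruledDual (h (j + 1)) (h (j + 1 + 1)) (s (j + 1)) x =
      ruledDual (h j) (h (j + 1)) (s j) x + c • apex h s r 0 := fun j => by
    obtain ⟨t, -, ht⟩ := hd.apex_eq_smul hh hv j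
    obtain ⟨c, hc⟩ := hd.ruledDual_succ j (x := x) (by rw [ht, lp_smul_left, hx, mul_zero])
    rw [ht, smul_smul] at hc
    exact ⟨_, by rw [add_assoc, one_add_one_eq_two]; exact hc⟩
  induction j using Int.induction_on with
  | zero => exact ⟨0, by simp⟩
  | succ k ih =>
    obtain ⟨c, hc⟩ := ih
    obtain ⟨d, hd⟩ := step k
    exact ⟨c + d, by rw [hd, hc]; module⟩
  | pred k ih =>
    obtain ⟨c, hc⟩ := ih
    obtain ⟨d, hd⟩ := step (-(k : ℤ) - 1)
    rw [sub_add_cancel, hc] at hd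
    exact ⟨c - d, by rw [sub_add_cancel, sub_smul, ← add_sub_assoc, hd]; module⟩

theorem StripData.lp_ruledDual_self (hd : StripData h v s r) (hu : ∀ i, lp (v i) (v i) = 1)
    (i : ℤ) : lp (ruledDual (h 0) (h 1) (s 0) (v i)) (v i) = 0 := by
  obtain ⟨w, h1, -, h3⟩ := hd.angle i 0
  have h0 := hd.ne_zero 0
  rw [zero_add] at h1 h3
  rw [ruledDual_eq h0 (hd.sq_add _)]
  simp only [lp_sub_left, lp_smul_left, h1, hu]
  field_simp
  linarith

/-- The conic of the points `v i` is regular. -/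
theorem StripData.lp_ruledDual_ne_zero (hd : StripData h v s r) (hh : NormalsIndependent h)
    (hv : NormalsIndependent v) (hu : ∀ i, lp (h i) (h i) = 1) (hu' : ∀ i, lp (v i) (v i) = 1)
    {a b : ℤ} (hab : a ≠ b) : lp (ruledDual (h 0) (h 1) (s 0) (v a)) (v b) ≠ 0 := by
  intro h0
  obtain ⟨f, hf0, hf1, hf⟩ : ∃ f : Fin 5 → ℤ, f 0 = a ∧ f 1 = b ∧ Function.Injective f := by
    obtain ⟨c, hc⟩ := Infinite.exists_notMem_finset ({a, b} : Finset ℤ)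
    obtain ⟨d, hd⟩ := Infinite.exists_notMem_finset ({a, b, c} : Finset ℤ)
    obtain ⟨e, he⟩ := Infinite.exists_notMem_finset ({a, b, c, d} : Finset ℤ)
    simp only [Finset.mem_insert, Finset.mem_singleton, not_or] at hc hd he
    refine ⟨![a, b, c, d, e], rfl, rfl, fun i j hij => ?_⟩
    fin_cases i <;> fin_cases j <;> simp_all
  have hk := hd.apex_ne_zero hh 0
  have hko := fun i => hd.lp_apex i 0
  have hself := hd.lp_ruledDual_self hu'
  have Bc : ∀ p q, lp (ruledDual (h 0) (h 1) (s 0) p) q = lp (ruledDual (h 0) (h 1) (s 0) q) p :=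
    fun p q => by rw [lp_ruledDual, lp_comm]
  have ind : ∀ a b c, a ≠ b → b ≠ c → a ≠ c → ∀ r s t : ℝ,
      r • v (f a) + s • v (f b) + t • v (f c) = 0 → r = 0 ∧ s = 0 ∧ t = 0 :=
    fun a b c h1 h2 h3 => hv _ _ _ (hf.ne h1) (hf.ne h2) (hf.ne h3)
  obtain ⟨h02, h12⟩ := conjugate_of_five_points Bc (fun r t u p q q' w => by
      rw [Bc, Bc p, Bc q, Bc q']
      simp only [lp_add_right, lp_smul_right]) hk (p := fun i => v (f i)) (fun i => hko _)
    (fun i => hself _) ind (by rw [hf0, hf1]; exact h0)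
  have ko := fun i => (lp_comm (v i) (apex h s r 0)).trans (hko i)
  have s2 : 1 - s 0 ^ 2 ≠ 0 := by rw [← hd.sq_add]; exact pow_ne_zero 2 (hd.ne_zero 0)
  have ind' := ind 0 1 2 (by decide) (by decide) (by decide)
  rw [hf0] at h02 ind'
  rw [hf1] at h12 ind'
  obtain ⟨α, hα⟩ := eq_smul_of_orthogonal_triple ind' hk (ko _) (ko _) (ko _)
    (x := ruledDual (h 0) (h 1) (s 0) (v a)) (by rw [lp_comm]; exact hself a)
    (by rw [lp_comm]; exact h0) (by rw [lp_comm]; exact h02)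
  obtain ⟨β, hβ⟩ := eq_smul_of_orthogonal_triple ind' hk (ko _) (ko _) (ko _)
    (x := ruledDual (h 0) (h 1) (s 0) (v b)) (by rw [lp_comm]; exact (Bc _ _).trans h0)
    (by rw [lp_comm]; exact hself b) (by rw [lp_comm]; exact h12)
  -- Both dual images are multiples of the apex; applying the inverse operator would make `v a` and
  -- `v b` proportional.
  have ra := ruledOp_ruledDual (hu 0) (hu 1) s2 (hd.ne_lp 0) (v a)
  have rb := ruledOp_ruledDual (hu 0) (hu 1) s2 (hd.ne_lp 0) (v b)
  rw [hα, ruledOp_smul] at ra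
  rw [hβ, ruledOp_smul] at rb
  have hβ0 : β ≠ 0 := by
    rintro rfl
    rw [zero_smul] at rb
    have := hu' b
    rw [← rb, lp, bil_zero_left] at this
    norm_num at this
  apply hv.ne_smul hab (α / β)
  rw [← ra, ← rb, smul_smul, div_mul_cancel₀ _ hβ0]

/-- This makes the tangent cone well defined: the apex is off the quadric. Otherwise its polar
vector would lie in the span of the `v i` and be conjugate to all of it, but the conic there is
regular because the `v i` are pairwise not conjugate. -/
theorem StripData.lp_apex_ruledOp_ne_zero (hd : StripData h v s r) (hh : NormalsIndependent h)
    (hv : NormalsIndependent v) (hu : ∀ i, lp (h i) (h i) = 1) (hu' : ∀ i, lp (v i) (v i) = 1) :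
    lp (apex h s r 0) (ruledOp (h 0) (h 1) (s 0) (apex h s r 0)) ≠ 0 := by
  intro h0
  have hk := hd.apex_ne_zero hh 0
  have hko := fun i => hd.lp_apex i 0
  have ind := fun r s t => hv 0 1 2 (by decide) (by decide) (by decide) r s t
  have s2 : 1 - s 0 ^ 2 ≠ 0 := by rw [← hd.sq_add]; exact pow_ne_zero 2 (hd.ne_zero 0)
  have hFR := ruledDual_ruledOp (hu 0) (hu 1) s2 (hd.ne_lp 0) (apex h s r 0)
  obtain ⟨α, β, γ, e⟩ := exists_coeff_of_orthogonal ind hk (hko 0) (hko 1) (hko 2) h0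
  have key : ∀ i, α * lp (ruledDual (h 0) (h 1) (s 0) (v i)) (v 0) +
      β * lp (ruledDual (h 0) (h 1) (s 0) (v i)) (v 1) +
      γ * lp (ruledDual (h 0) (h 1) (s 0) (v i)) (v 2) = 0 := fun i => by
    rw [← lp_smul_right, ← lp_smul_right, ← lp_smul_right, ← lp_add_right, ← lp_add_right, ← e,
      lp_ruledDual, hFR, lp_comm, hko]
  have n01 := hd.lp_ruledDual_ne_zero hh hv hu hu' (show (0 : ℤ) ≠ 1 by decide)
  have n02 := hd.lp_ruledDual_ne_zero hh hv hu hu' (show (0 : ℤ) ≠ 2 by decide)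
  have n12 := hd.lp_ruledDual_ne_zero hh hv hu hu' (show (1 : ℤ) ≠ 2 by decide)
  have c01 := (lp_ruledDual (h := h 0) (h' := h 1) (s := s 0) (v 1) (v 0)).trans (lp_comm _ _)
  have c02 := (lp_ruledDual (h := h 0) (h' := h 1) (s := s 0) (v 2) (v 0)).trans (lp_comm _ _)
  have c12 := (lp_ruledDual (h := h 0) (h' := h 1) (s := s 0) (v 2) (v 1)).trans (lp_comm _ _)
  have k0 := key 0
  have k1 := key 1
  have k2 := key 2
  rw [hd.lp_ruledDual_self hu'] at k0 k1 k2
  rw [c01] at k1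
  rw [c02, c12] at k2
  set f01 := lp (ruledDual (h 0) (h 1) (s 0) (v 0)) (v 1)
  set f02 := lp (ruledDual (h 0) (h 1) (s 0) (v 0)) (v 2)
  set f12 := lp (ruledDual (h 0) (h 1) (s 0) (v 1)) (v 2)
  have hγ : γ = 0 := by
    have : 2 * f02 * f12 * γ = 0 := by linear_combination f12 * k0 + f02 * k1 - f01 * k2
    simpa [n02, n12] using this
  have hβ : β = 0 := by simpa [hγ, n01] using k0
  have hα : α = 0 := by simpa [hγ, n01] using k1
  rw [hα, hβ, hγ] at e
  apply hk
  rw [← hFR, e]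
  simp [ruledDual, lp, bil_zero_right]

/-- The cone that is tangent to all planes with normals `v i`. -/
theorem StripData.exists_cone (hd : StripData h v s r) (hh : NormalsIndependent h)
    (hv : NormalsIndependent v) (hu : ∀ i, lp (h i) (h i) = 1) (hu' : ∀ i, lp (v i) (v i) = 1) :
    ∃ K : Form 2, K.IsSymm ∧
      (∃ k : Vec 2, k ≠ 0 ∧ K.mulVec k = 0) ∧
      (∃ k : Vec 2, k ≠ 0 ∧ (K - lorentz 2).mulVec k = 0) ∧
      (∀ i, ∃ (p : Vec 2) (c : ℝ), c ≠ 0 ∧ K.mulVec p = c • (lorentz 2).mulVec (v i) ∧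
        bil K p p = 0) ∧
      ∀ j, ∃ (p : Vec 2) (c : ℝ), c ≠ 0 ∧
        (K - lorentz 2).mulVec p = c • (lorentz 2).mulVec (h j) ∧
        bil (K - lorentz 2) p p = 0 := by
  have s2 : ∀ j, 1 - s j ^ 2 ≠ 0 := fun j => by
    rw [← hd.sq_add]; exact pow_ne_zero 2 (hd.ne_zero j)
  set k := apex h s r 0 with hkdef
  have hk : k ≠ 0 := hd.apex_ne_zero hh 0
  have hkk := hd.lp_apex_ruledOp_ne_zero hh hv hu hu'
  let K := tangentCone (h 0) (h 1) (s 0) k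
  have hKk : K.mulVec k = 0 := by
    rw [tangentCone_mulVec, inv_mul_cancel₀ hkk, one_smul, sub_self, Matrix.mulVec_zero]
  have hKF : ∀ x, lp k x = 0 →
      K.mulVec (ruledDual (h 0) (h 1) (s 0) x) = (lorentz 2).mulVec x := fun x hx => by
    rw [tangentCone_mulVec, ruledOp_ruledDual (hu 0) (hu 1) (s2 0) (hd.ne_lp 0), hx, mul_zero,
      zero_smul, sub_zero]
  -- On the polar plane of the apex the cone has the same polarity as the quadric of any strip, not
  -- only of strip 0, because the duals agree modulo `k` and `K` kills `k`.
  have hKR : ∀ j x, lp k (ruledOp (h j) (h (j + 1)) (s j) x) = 0 →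
      K.mulVec x = (lorentz 2).mulVec (ruledOp (h j) (h (j + 1)) (s j) x) := fun j x hx => by
    obtain ⟨c, hc⟩ := hd.ruledDual_sub hh hv hx j
    rw [ruledDual_ruledOp (hu _) (hu _) (s2 j) (hd.ne_lp j)] at hc
    conv_lhs => rw [hc]
    rw [Matrix.mulVec_add, Matrix.mulVec_smul, hKk, smul_zero, add_zero, hKF _ hx]
  have hKL : ∀ j p, lp (h j) p = 0 → lp (ruledOp (h j) (h (j + 1)) (s j) k) p = 0 →
      (K - lorentz 2).mulVec p = ((s j - lp (h j) (h (j + 1)))⁻¹ * lp (h (j + 1)) p) •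
        (lorentz 2).mulVec (h j) := fun j p h1 h2 => by
    rw [lp_ruledOp] at h2
    rw [Matrix.sub_mulVec, hKR j p h2, ruledOp, h1, zero_smul, add_zero, Matrix.mulVec_add,
      Matrix.mulVec_smul, Matrix.mulVec_smul, smul_smul]
    abel
  refine ⟨K, tangentCone_isSymm k, ⟨k, hk, hKk⟩, ?_, fun i => ?_, fun j => ?_⟩
  -- The apex of the second cone is the common point of the planes of `h 0`, `h 1` and the polar
  -- plane of `k`: three equations in four unknowns.
  · have hlt : Module.finrank ℝ (Fin 3 → ℝ) < Module.finrank ℝ (Vec 2) := by simp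
    obtain ⟨p, hp, hp0⟩ := (Submodule.ne_bot_iff _).mp (LinearMap.ker_ne_bot_of_finrank_lt
      (f := lpTriple (h 0) (h (0 + 1)) (ruledOp (h 0) (h (0 + 1)) (s 0) k)) hlt)
    obtain ⟨h1, h2, h3⟩ := mem_ker_lpTriple.mp hp
    exact ⟨p, hp0, by rw [hKL 0 p h1 h3, h2, mul_zero, zero_smul]⟩
  · refine ⟨ruledDual (h 0) (h 1) (s 0) (v i), 1, one_ne_zero, ?_, ?_⟩
    · rw [hKF _ (hd.lp_apex i 0), one_smul]
    · rw [bil, hKF _ (hd.lp_apex i 0)]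
      exact hd.lp_ruledDual_self hu' i
  · obtain ⟨c, hc0, hc⟩ := hd.apex_eq_smul hh hv j
    -- A contact point in `H j` must also lie on the polar plane of `k` but off `H (j + 1)`, so that
    -- the factor in `hKL` is nonzero. Independence holds because the apex is not in the span of `h
    -- j` and `h (j + 1)`.
    have hsurj := lpTriple_surjective (a := h j) (b := ruledOp (h j) (h (j + 1)) (s j) k)
      (c := h (j + 1)) (fun a b d e => by
        have hb : b = 0 := by
          by_contra hb
          rw [ruledOp] at e
          set t := (s j - lp (h j) (h (j + 1)))⁻¹
          have e' : b • k = (-(a + b * t * lp (h (j + 1)) k)) • h j +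
              (-(d + b * t * lp (h j) k)) • h (j + 1) := by
            linear_combination (norm := module) e
          apply hd.apex_notMem hh j (c * b⁻¹ * -(a + b * t * lp (h (j + 1)) k))
            (c * b⁻¹ * -(d + b * t * lp (h j) k))
          rw [hc, mul_smul (c * b⁻¹), mul_smul (c * b⁻¹), ← smul_add, ← e', smul_smul,
            inv_mul_cancel_right₀ hb]
        subst hb
        rw [zero_smul, add_zero] at e
        have := hh j (j + 1) (j + 2) (by simp) (by simp) (by simp) a d 0 (by rw [e]; simp)
        exact ⟨this.1, rfl, this.2.1⟩)
    obtain ⟨p, hp⟩ := hsurj ![0, 0, 1]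
    have p1 : lp (h j) p = 0 := congrFun hp 0
    have p2 : lp (ruledOp (h j) (h (j + 1)) (s j) k) p = 0 := congrFun hp 1
    have p3 : lp (h (j + 1)) p = 1 := congrFun hp 2
    refine ⟨p, _, ?_, hKL j p p1 p2, ?_⟩
    · rw [p3, mul_one]
      exact inv_ne_zero (sub_ne_zero.mpr (hd.ne_lp j))
    · rw [bil, hKL j p p1 p2, dotProduct_smul]
      change _ • lp p (h j) = 0
      rw [lp_comm p, p1, smul_zero]

end Family

/-! ### Complexification of forms and planes -/

section Complex

variable {n : ℕ}

/-- The complex coordinate vector of a real one. -/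
noncomputable def toC (x : Vec n) : CVec n := fun k => (x k : ℂ)

theorem cpolar_add (A : Form n) (x y : CVec n) : cpolar A (x + y) = cpolar A x + cpolar A y :=
  Matrix.mulVec_add _ _ _

theorem cpolar_smul (A : Form n) (c : ℂ) (x : CVec n) : cpolar A (c • x) = c • cpolar A x :=
  Matrix.mulVec_smul _ _ _

theorem cpolar_toC (A : Form n) (x : Vec n) : cpolar A (toC x) = toC (A.mulVec x) := by
  ext k
  simp [cpolar, toC, Matrix.mulVec, dotProduct]

theorem cpolar_pencil (A B : Form n) (a b : ℝ) (x : CVec n) :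
    cpolar (a • A + b • B) x = (a : ℂ) • cpolar A x + (b : ℂ) • cpolar B x := by
  ext k
  simp only [cpolar, Matrix.mulVec, dotProduct, Matrix.map_apply, Matrix.add_apply,
    Matrix.smul_apply, smul_eq_mul, Pi.add_apply, Pi.smul_apply, Finset.mul_sum,
    ← Finset.sum_add_distrib]
  refine Finset.sum_congr rfl fun i _ => ?_
  push_cast
  ring

theorem cbil_add_left (A : Form n) (x y z : CVec n) : cbil A (x + y) z = cbil A x z + cbil A y z :=
  add_dotProduct _ _ _

theorem cbil_smul_left (A : Form n) (c : ℂ) (x y : CVec n) : cbil A (c • x) y = c * cbil A x y :=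
  smul_dotProduct _ _ _

theorem cbil_add_right (A : Form n) (x y z : CVec n) :
    cbil A x (y + z) = cbil A x y + cbil A x z := by
  rw [cbil, cpolar_add, dotProduct_add]; rfl

theorem cbil_smul_right (A : Form n) (c : ℂ) (x y : CVec n) :
    cbil A x (c • y) = c * cbil A x y := by
  rw [cbil, cpolar_smul, dotProduct_smul]; rfl

theorem cbil_toC (A : Form n) (x y : Vec n) : cbil A (toC x) (toC y) = (bil A x y : ℂ) := by
  rw [cbil, cpolar_toC]
  simp [bil, toC, dotProduct]

theorem cbil_lorentz_toC (x y : Vec n) :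
    cbil (lorentz n) (toC x) (toC y) = (lp x y : ℂ) := cbil_toC _ x y

theorem cbil_pencil (A B : Form n) (a b : ℝ) (x y : CVec n) :
    cbil (a • A + b • B) x y = a * cbil A x y + b * cbil B x y := by
  rw [cbil, cpolar_pencil, dotProduct_add, dotProduct_smul, dotProduct_smul]; rfl

theorem toC_smul (c : ℝ) (x : Vec n) : toC (c • x) = (c : ℂ) • toC x := by
  ext k; simp [toC]

theorem toC_add (x y : Vec n) : toC (x + y) = toC x + toC y := by
  ext k; simp [toC]

theorem toC_injective : Function.Injective (toC (n := n)) := fun x y h => by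
  ext k
  exact Complex.ofReal_injective (congrFun h k)

theorem toC_mem_complexify {W : Submodule ℝ (Vec n)} {x : Vec n} (hx : x ∈ W) :
    toC x ∈ complexify W := Submodule.subset_span ⟨x, hx, rfl⟩

theorem cbil_lorentz_toC_zero {h : Vec n} {W : Submodule ℝ (Vec n)} (hW : IsUnitNormal h W)
    {w : CVec n} (hw : w ∈ complexify W) : cbil (lorentz n) w (toC h) = 0 := by
  induction hw using Submodule.span_induction with
  | mem x hx =>
    obtain ⟨y, hy, rfl⟩ := hx
    change cbil _ (toC y) _ = 0
    rw [cbil_lorentz_toC, lp_comm, (hW.mem_iff y).mp hy, Complex.ofReal_zero]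
  | zero => simp [cbil]
  | add x y _ _ hx hy => rw [cbil_add_left, hx, hy, add_zero]
  | smul c x _ hx => rw [cbil_smul_left, hx, mul_zero]

/-- The normal is real, so orthogonality splits into real and imaginary parts. -/
theorem exists_re_im {h : Vec n} {W : Submodule ℝ (Vec n)} (hW : IsUnitNormal h W)
    {w : CVec n} (hw : cbil (lorentz n) w (toC h) = 0) :
    ∃ x ∈ W, ∃ y ∈ W, w = toC x + Complex.I • toC y := by
  have e : w = toC (fun k => (w k).re) + Complex.I • toC (fun k => (w k).im) := by
    ext k
    simp only [toC, Pi.add_apply, Pi.smul_apply, smul_eq_mul]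
    rw [mul_comm, Complex.re_add_im]
  rw [e, cbil_add_left, cbil_smul_left, cbil_toC, cbil_toC, mul_comm, Complex.ext_iff] at hw
  simp only [Complex.add_re, Complex.ofReal_re, Complex.mul_re, Complex.I_re, mul_zero,
    Complex.ofReal_im, Complex.I_im, mul_one, sub_self, add_zero, Complex.zero_re, Complex.add_im,
    Complex.mul_im, zero_add, Complex.zero_im] at hw
  exact ⟨_, (hW.mem_iff _).mpr ((lp_comm _ _).trans hw.1), _,
    (hW.mem_iff _).mpr ((lp_comm _ _).trans hw.2), e⟩

theorem mem_complexify_iff {h : Vec n} {W : Submodule ℝ (Vec n)} (hW : IsUnitNormal h W)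
    {w : CVec n} : w ∈ complexify W ↔ cbil (lorentz n) w (toC h) = 0 := by
  refine ⟨cbil_lorentz_toC_zero hW, fun hw => ?_⟩
  obtain ⟨x, hx, y, hy, rfl⟩ := exists_re_im hW hw
  exact add_mem (toC_mem_complexify hx) (Submodule.smul_mem _ _ (toC_mem_complexify hy))

theorem exists_complex_coeff {h : Vec n} {W : Submodule ℝ (Vec n)} (hW : IsUnitNormal h W)
    (h3 : Module.finrank ℝ W = 3) {x y z : Vec n} (hi : LinearIndependent ℝ ![x, y, z])
    (hx : x ∈ W) (hy : y ∈ W) (hz : z ∈ W) {w : CVec n} (hw : w ∈ complexify W) :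
    ∃ a b c : ℂ, w = a • toC x + b • toC y + c • toC z := by
  obtain ⟨u, hu, t, ht, rfl⟩ := exists_re_im hW ((mem_complexify_iff hW).mp hw)
  obtain ⟨a, b, c, rfl⟩ := exists_coeff_of_mem h3 hi hx hy hz hu
  obtain ⟨a', b', c', rfl⟩ := exists_coeff_of_mem h3 hi hx hy hz ht
  refine ⟨a + Complex.I * a', b + Complex.I * b', c + Complex.I * c', ?_⟩
  simp only [toC_add, toC_smul]
  module

end Complex

/-! ### Contact of a circle with the cyclic along a tangent plane of a cone -/

section Tangency

/-- A plane `W` with unit normal `v` touches the quadratic cone `K` with apex `k` along the line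
spanned by `k` and `p`. -/
structure TouchesCone (K : Form 2) (k v p : Vec 2) (c : ℝ) (W : Submodule ℝ (Vec 2)) : Prop where
  symm : K.IsSymm
  ker : ∀ x, K.mulVec x = 0 ↔ ∃ t : ℝ, x = t • k
  apex : lp k k ≠ 0
  finrank : Module.finrank ℝ W = 3
  normal : IsUnitNormal v W
  ne_zero : c ≠ 0
  polar : K.mulVec p = c • (lorentz 2).mulVec v
  null : bil K p p = 0
  orthogonal : lp k p = 0

variable {K : Form 2} {k v p : Vec 2} {c : ℝ} {W : Submodule ℝ (Vec 2)}

theorem TouchesCone.bil_apex (h : TouchesCone K k v p c W) (x : Vec 2) : bil K x k = 0 := by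
  rw [bil, (h.ker k).mpr ⟨1, (one_smul _ _).symm⟩, dotProduct_zero]

theorem TouchesCone.bil_contact (h : TouchesCone K k v p c W) (x : Vec 2) :
    bil K x p = c * lp v x := by
  rw [bil, h.polar, dotProduct_smul, smul_eq_mul, lp_comm]; rfl

theorem TouchesCone.lp_contact (h : TouchesCone K k v p c W) : lp v p = 0 := by
  have := h.bil_contact p
  rw [h.null] at this
  simpa [h.ne_zero] using this.symm

theorem TouchesCone.lp_normal_apex (h : TouchesCone K k v p c W) : lp v k = 0 := by
  have := h.bil_contact k
  rw [bil_comm h.symm, h.bil_apex] at this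
  simpa [h.ne_zero] using this.symm

theorem TouchesCone.apex_mem (h : TouchesCone K k v p c W) : k ∈ W :=
  (h.normal.mem_iff k).mpr h.lp_normal_apex

theorem TouchesCone.contact_mem (h : TouchesCone K k v p c W) : p ∈ W :=
  (h.normal.mem_iff p).mpr h.lp_contact

theorem TouchesCone.apex_ne_zero (h : TouchesCone K k v p c W) : k ≠ 0 := by
  rintro rfl
  exact h.apex (bil_zero_left _ _)

theorem TouchesCone.contact_ne_zero (h : TouchesCone K k v p c W) : p ≠ 0 := by
  rintro rfl
  have := h.bil_contact v
  rw [bil_zero_right, h.normal.unit, mul_one] at this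
  exact h.ne_zero this.symm

/-- A further vector of the tangent plane off the line of contact. -/
theorem TouchesCone.exists_transversal (h : TouchesCone K k v p c W) :
    ∃ q ∈ W, LinearIndependent ℝ ![k, p, q] ∧ bil K q q ≠ 0 := by
  obtain ⟨q, hq, hqs⟩ : ∃ q ∈ W, q ∉ Submodule.span ℝ {k, p} := by
    by_contra! hne
    have h1 := Submodule.finrank_mono (show W ≤ Submodule.span ℝ {k, p} from hne)
    have h2 := finrank_span_finset_le_card (R := ℝ) ({k, p} : Finset (Vec 2))
    rw [Finset.coe_pair] at h2
    have h3 := Finset.card_le_two (a := k) (b := p)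
    have h4 := h.finrank
    simp only [Set.finrank] at h2
    omega
  rw [Submodule.mem_span_pair, not_exists] at hqs
  have ind : ∀ r s t : ℝ, r • k + s • p + t • q = 0 → r = 0 ∧ s = 0 ∧ t = 0 := fun r s t e => by
    have ht : t = 0 := by
      by_contra ht
      apply hqs (-(t⁻¹ * r))
      refine ⟨-(t⁻¹ * s), ?_⟩
      have : t⁻¹ • (r • k + s • p + t • q) = 0 := by rw [e, smul_zero]
      rw [smul_add, smul_smul t⁻¹ t, inv_mul_cancel₀ ht, one_smul] at this
      linear_combination (norm := module) -this
    subst ht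
    rw [zero_smul, add_zero] at e
    have hs : s = 0 := by
      have := congrArg (bil K v) e
      rw [bil_add_right, bil_smul_right, bil_smul_right, h.bil_apex, h.bil_contact, h.normal.unit,
        bil_zero_right] at this
      simpa [h.ne_zero] using this
    subst hs
    rw [zero_smul, add_zero] at e
    exact ⟨(smul_eq_zero.mp e).resolve_right h.apex_ne_zero, rfl, rfl⟩
  have hi := linearIndependent_of_coeff ind
  refine ⟨q, hq, hi, fun h0 => ?_⟩
  -- If `q` were isotropic, its polar plane would contain `W`; then `q` would differ from a multiple
  -- of `p` by an element of the kernel and lie on the line of contact.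
  have hW : ∀ w ∈ W, bil K q w = 0 := fun w hw => by
    obtain ⟨r, s, t, rfl⟩ := exists_coeff_of_mem h.finrank hi h.apex_mem h.contact_mem hq hw
    rw [bil_add_right, bil_add_right, bil_smul_right, bil_smul_right, bil_smul_right, h.bil_apex,
      h.bil_contact, (h.normal.mem_iff q).mp hq, h0]
    ring
  obtain ⟨t, ht⟩ := eq_smul_of_le (h' := (lorentz 2).mulVec (K.mulVec q)) h.normal
    (fun w hw => by
      rw [lp, bil_eq_mulVec_dotProduct lorentz_isSymm, lorentz_mulVec_mulVec,
        ← bil_eq_mulVec_dotProduct h.symm, hW w hw])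
  have hKq : K.mulVec (q - (t / c) • p) = 0 := by
    have := congrArg (lorentz 2).mulVec ht
    rw [lorentz_mulVec_mulVec, Matrix.mulVec_smul] at this
    rw [Matrix.mulVec_sub, Matrix.mulVec_smul, this, h.polar, smul_smul,
      div_mul_cancel₀ _ h.ne_zero, sub_self]
  obtain ⟨r, hr⟩ := (h.ker _).mp hKq
  apply hqs r
  refine ⟨t / c, ?_⟩
  rw [← hr]
  abel

variable {D : DarbouxCyclide 2} {a b : ℝ}

/-- The cone belongs to the pencil and has tangent plane `W` at `z`, so the tangent planes of
`D.form` and `lorentz 2` at `z` intersect in the same line as `W` and the latter. -/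
theorem TouchesCone.tangentAt (h : TouchesCone (a • lorentz 2 + b • D.form) k v p c W)
    (hb : b ≠ 0) {z : CVec 2} (hz : z ≠ 0) (hzW : z ∈ complexify W)
    (hzz : cbil (lorentz 2) z z = 0) {γ : ℂ} (hγ : γ ≠ 0)
    (hp : cpolar (a • lorentz 2 + b • D.form) z = γ • cpolar (lorentz 2) (toC v)) :
    D.TangentAt W z := by
  have hbC : (b : ℂ) ≠ 0 := Complex.ofReal_ne_zero.mpr hb
  rw [cpolar_pencil] at hp
  have hD : cpolar D.form z =
      ((b : ℂ)⁻¹ * γ) • cpolar (lorentz 2) (toC v) - ((b : ℂ)⁻¹ * a) • cpolar (lorentz 2) z := by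
    rw [mul_smul, mul_smul, ← hp, ← smul_sub, add_sub_cancel_left, smul_smul,
      inv_mul_cancel₀ hbC, one_smul]
  have hDw : ∀ w, cbil D.form w z = ((b : ℂ)⁻¹ * γ) * cbil (lorentz 2) w (toC v) -
      ((b : ℂ)⁻¹ * a) * cbil (lorentz 2) w z := fun w => by
    rw [cbil, hD, dotProduct_sub, dotProduct_smul, dotProduct_smul]; rfl
  have hzv := (mem_complexify_iff h.normal).mp hzW
  have hg : (b : ℂ)⁻¹ * γ ≠ 0 := mul_ne_zero (inv_ne_zero hbC) hγ
  refine ⟨⟨hz, hzz, by rw [hDw, hzv, hzz]; ring⟩, hzW, ?_, fun w => ?_⟩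
  · rw [LinearIndependent.pair_iff]
    intro x y e
    have hv : ∀ w, x * cbil (lorentz 2) w z + y * cbil D.form w z = 0 := fun w => by
      have := congrArg (dotProduct w) e
      rwa [dotProduct_add, dotProduct_smul, dotProduct_smul, dotProduct_zero] at this
    have vv : cbil (lorentz 2) (toC v) (toC v) = 1 := by
      rw [cbil_toC]
      exact_mod_cast h.normal.unit
    have vz : cbil (lorentz 2) (toC v) z = 0 := by
      obtain ⟨u, hu, t, ht, rfl⟩ := exists_re_im h.normal hzv
      rw [cbil_add_right, cbil_smul_right, cbil_lorentz_toC, cbil_lorentz_toC, (h.normal.mem_iff u).mp hu,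
        (h.normal.mem_iff t).mp ht]
      simp
    have hy : y = 0 := by
      have := hv (toC v)
      rw [hDw, vz, vv] at this
      simpa [hbC, hγ] using this
    subst hy
    refine ⟨?_, rfl⟩
    by_contra hx
    apply hz
    rw [zero_smul, add_zero] at e
    have e' := (smul_eq_zero.mp e).resolve_left hx
    have hzc : z = cpolar (lorentz 2) (cpolar (lorentz 2) z) := by
      rw [cpolar, cpolar, Matrix.mulVec_mulVec]
      have : (lorentz 2).map (fun r : ℝ => (r : ℂ)) * (lorentz 2).map (fun r : ℝ => (r : ℂ)) =
          1 := by
        have := congrArg (fun M : Form 2 => M.map Complex.ofRealHom) (lorentz_mul_lorentz (n := 2))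
        simp only [Matrix.map_mul, Matrix.map_one _ (map_zero _) (map_one _)] at this
        exact this
      rw [this, Matrix.one_mulVec]
    rw [hzc, e', cpolar, Matrix.mulVec_zero]
  · rw [mem_complexify_iff h.normal, hDw]
    constructor
    · rintro ⟨h1, h2⟩
      rw [h1, mul_zero, sub_zero] at h2
      exact ⟨(mul_eq_zero.mp h2).resolve_left hg, h1⟩
    · rintro ⟨h1, h2⟩
      exact ⟨h2, by rw [h1, h2]; ring⟩

theorem TouchesCone.tangentAtTwoPoints
    (h : TouchesCone (a • lorentz 2 + b • D.form) k v p c W) (hb : b ≠ 0) (hpp : lp p p ≠ 0) :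
    D.TangentAtTwoPoints W := by
  obtain ⟨q, hq, hi, hqq⟩ := h.exists_transversal
  have hppC : (lp p p : ℂ) ≠ 0 := Complex.ofReal_ne_zero.mpr hpp
  have hkkC : (lp k k : ℂ) ≠ 0 := Complex.ofReal_ne_zero.mpr h.apex
  -- As `k` and `p` are orthogonal, the points of the Möbius quadric on the line of contact are `k ±
  -- κ p` with this square.
  obtain ⟨κ, hκ⟩ := IsAlgClosed.exists_pow_nat_eq (-(lp k k : ℂ) / lp p p) (n := 2) (by norm_num)
  have hκ' : κ ^ 2 * lp p p = -lp k k := by rw [hκ]; field_simp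
  have hκ0 : κ ≠ 0 := by
    rintro rfl
    apply hkkC
    rw [← neg_eq_zero, ← hκ']
    ring
  have hJ : ∀ x y : ℂ, cbil (lorentz 2) (x • toC k + y • toC p) (x • toC k + y • toC p) =
      x ^ 2 * lp k k + y ^ 2 * lp p p := fun x y => by
    simp only [cbil_add_left, cbil_add_right, cbil_smul_left, cbil_smul_right, cbil_toC]
    have h1 := h.orthogonal
    have h2 := (lp_comm p k).trans h1
    simp only [lp] at h1 h2 ⊢
    rw [h1, h2, Complex.ofReal_zero]
    ring
  have hind : LinearIndependent ℂ ![toC k, toC p] := by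
    rw [LinearIndependent.pair_iff]
    intro x y e
    have e1 := congrArg (cbil (lorentz 2) (toC k)) e
    have e2 := congrArg (cbil (lorentz 2) (toC p)) e
    have h1 := h.orthogonal
    have h2 := (lp_comm p k).trans h1
    have hz : ∀ w, cbil (lorentz 2) w (0 : CVec 2) = 0 := fun w => by
      simp [cbil, cpolar]
    rw [cbil_add_right, cbil_smul_right, cbil_smul_right, cbil_lorentz_toC, cbil_lorentz_toC, h1,
      hz] at e1
    rw [cbil_add_right, cbil_smul_right, cbil_smul_right, cbil_lorentz_toC, cbil_lorentz_toC, h2,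
      hz] at e2
    simp only [Complex.ofReal_zero, mul_zero, add_zero, zero_add] at e1 e2
    exact ⟨(mul_eq_zero.mp e1).resolve_right hkkC, (mul_eq_zero.mp e2).resolve_right hppC⟩
  have hpair := LinearIndependent.pair_iff.mp hind
  have tang : ∀ μ : ℂ, μ ^ 2 = κ ^ 2 → D.TangentAt W (toC k + μ • toC p) := fun μ hμ => by
    have hμ0 : μ ≠ 0 := by
      rintro rfl
      apply hκ0
      rw [← pow_eq_zero_iff (n := 2) two_ne_zero, ← hμ]
      ring
    refine h.tangentAt hb (fun h0 => ?_) ?_ ?_ (γ := μ * c) ?_ ?_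
    · have := hpair 1 μ (by rw [one_smul, h0])
      exact one_ne_zero this.1
    · exact add_mem (toC_mem_complexify h.apex_mem)
        (Submodule.smul_mem _ _ (toC_mem_complexify h.contact_mem))
    · have := hJ 1 μ
      rw [one_smul] at this
      rw [this, hμ, hκ']
      ring
    · exact mul_ne_zero hμ0 (Complex.ofReal_ne_zero.mpr h.ne_zero)
    · rw [cpolar_add, cpolar_smul, cpolar_toC, cpolar_toC, cpolar_toC, h.polar, toC_smul,
        (h.ker k).mpr ⟨1, (one_smul _ _).symm⟩, smul_smul]
      have : toC (0 : Vec 2) = 0 := by ext k; simp [toC]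
      rw [this, zero_add]
  refine ⟨toC k + κ • toC p, toC k + (-κ) • toC p, ?_, tang κ rfl, tang (-κ) (by ring), ?_⟩
  · rw [LinearIndependent.pair_iff]
    intro x y e
    have := hpair (x + y) (x * κ - y * κ) (by rw [← e]; module)
    have h2 : x - y = 0 := by
      have h3 := this.2
      rw [← sub_mul] at h3
      exact (mul_eq_zero.mp h3).resolve_right hκ0
    exact ⟨by linear_combination (this.1 + h2) / 2, by linear_combination (this.1 - h2) / 2⟩
  · intro r hr hD
    obtain ⟨x, y, z, rfl⟩ := exists_complex_coeff h.normal h.finrank hi h.apex_mem h.contact_mem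
      hq hr
    have hK : cbil (a • lorentz 2 + b • D.form) (x • toC k + y • toC p + z • toC q)
        (x • toC k + y • toC p + z • toC q) = 0 := by
      rw [cbil_pencil, hD.2.1, hD.2.2, mul_zero, mul_zero, add_zero]
    -- On `W` the cone restricts to `z ^ 2` times a nonzero constant, so every common point is on
    -- the line of contact.
    have hz : z = 0 := by
      simp only [cbil_add_left, cbil_add_right, cbil_smul_left, cbil_smul_right, cbil_toC,
        h.bil_apex, h.bil_contact, bil_comm h.symm k, bil_comm h.symm p q, h.lp_contact, h.lp_normal_apex,
        (h.normal.mem_iff q).mp hq, Complex.ofReal_zero, mul_zero, add_zero, zero_add] at hK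
      have hqC := Complex.ofReal_ne_zero.mpr hqq
      rcases mul_eq_zero.mp hK with h0 | h0
      · exact h0
      · exact (mul_eq_zero.mp h0).resolve_right hqC
    subst hz
    rw [zero_smul, add_zero] at hD ⊢
    have e := hD.2.1
    rw [hJ] at e
    have : (y - x * κ) * (y + x * κ) = 0 := by
      have : (lp p p : ℂ) * ((y - x * κ) * (y + x * κ)) = 0 := by
        linear_combination e - x ^ 2 * hκ'
      exact (mul_eq_zero.mp this).resolve_left hppC
    rw [Submodule.mem_span_singleton, Submodule.mem_span_singleton]
    rcases mul_eq_zero.mp this with h0 | h0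
    · left
      exact ⟨x, by rw [sub_eq_zero.mp h0]; module⟩
    · right
      exact ⟨x, by rw [eq_neg_of_add_eq_zero_left h0]; module⟩

theorem TouchesCone.tangentAtDoublePoint
    (h : TouchesCone (a • lorentz 2 + b • D.form) k v p c W) (hb : b ≠ 0) (hpp : lp p p = 0) :
    D.TangentAtDoublePoint W := by
  obtain ⟨q, hq, hi, hqq⟩ := h.exists_transversal
  have hbC : (b : ℂ) ≠ 0 := Complex.ofReal_ne_zero.mpr hb
  -- Otherwise `p` would be orthogonal to all of `W`, hence a multiple of the spacelike normal,
  -- although it is null.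
  have hqp : lp q p ≠ 0 := by
    intro h0
    obtain ⟨t, ht⟩ := eq_smul_of_le (h' := p) h.normal fun w hw => by
      obtain ⟨r, s, t, rfl⟩ := exists_coeff_of_mem h.finrank hi h.apex_mem h.contact_mem hq hw
      rw [lp_comm]
      simp only [lp_add_left, lp_smul_left, h.orthogonal, hpp, h0]
      ring
    rw [ht, lp_smul_left, lp_smul_right, h.normal.unit] at hpp
    have : t = 0 := by simpa using hpp
    apply h.contact_ne_zero
    rw [ht, this, zero_smul]
  have hqpC : (lp q p : ℂ) ≠ 0 := Complex.ofReal_ne_zero.mpr hqp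
  have hqqC := Complex.ofReal_ne_zero.mpr hqq
  refine ⟨toC p, h.tangentAt hb (fun h0 => h.contact_ne_zero (toC_injective ?_))
    (toC_mem_complexify h.contact_mem) (by rw [cbil_lorentz_toC, hpp, Complex.ofReal_zero])
    (Complex.ofReal_ne_zero.mpr h.ne_zero) ?_, -a / b,
    (bil (a • lorentz 2 + b • D.form) q q : ℂ) / (b * (lp q p : ℂ) ^ 2), ?_, ?_⟩
  · rw [h0]; ext k; simp [toC]
  · rw [cpolar_toC, h.polar, toC_smul, cpolar_toC]
  · exact div_ne_zero hqqC (mul_ne_zero hbC (pow_ne_zero 2 hqpC))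
  · intro w hw
    obtain ⟨x, y, z, rfl⟩ := exists_complex_coeff h.normal h.finrank hi h.apex_mem h.contact_mem
      hq hw
    have hJ : cbil (lorentz 2) (x • toC k + y • toC p + z • toC q) (toC p) = z * lp q p := by
      simp only [cbil_add_left, cbil_smul_left, cbil_toC]
      rw [show bil (lorentz 2) k p = 0 from h.orthogonal, show bil (lorentz 2) p p = 0 from hpp]
      simp
    have hK := cbil_pencil (lorentz 2) D.form a b (x • toC k + y • toC p + z • toC q)
      (x • toC k + y • toC p + z • toC q)
    have hK' : cbil (a • lorentz 2 + b • D.form) (x • toC k + y • toC p + z • toC q)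
        (x • toC k + y • toC p + z • toC q) =
        z ^ 2 * bil (a • lorentz 2 + b • D.form) q q := by
      simp only [cbil_add_left, cbil_add_right, cbil_smul_left, cbil_smul_right, cbil_toC,
        h.bil_apex, h.bil_contact, bil_comm h.symm k, bil_comm h.symm p q, h.lp_contact, h.lp_normal_apex,
        (h.normal.mem_iff q).mp hq, Complex.ofReal_zero, mul_zero, add_zero, zero_add]
      ring
    rw [hK'] at hK
    rw [hJ]
    generalize cbil (lorentz 2) (x • toC k + y • toC p + z • toC q)
      (x • toC k + y • toC p + z • toC q) = A at *
    generalize cbil D.form (x • toC k + y • toC p + z • toC q)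
      (x • toC k + y • toC p + z • toC q) = B at *
    field_simp
    linear_combination -hK

end Tangency

/-! ### Envelopes, the bound on double contacts, and the cyclic -/

section Families

variable {K : Form 2} {k : Vec 2}

/-- The tangency points of order four lie on two conics in the polar plane of the apex, so there
are at most four of them. -/
theorem encard_le_four {S : Set (Submodule ℝ (Vec 2))}
    (hS : ∀ W ∈ S, ∃ (v p : Vec 2) (c : ℝ), TouchesCone K k v p c W ∧ lp p p = 0) :
    S.encard ≤ 4 := by
  by_contra! hlt
  obtain ⟨T, hTS, hT⟩ := Set.exists_subset_encard_eq (s := S) (k := 5)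
    (by have := Order.add_one_le_of_lt hlt; norm_num at this; exact this)
  have hfin : T.Finite := Set.finite_of_encard_eq_coe hT
  have hcard : Nat.card T = 5 := by
    rw [Nat.card_coe_set_eq, Set.ncard, hT]; rfl
  have := hfin.to_subtype
  let e : Fin 5 ≃ T := (Finite.equivFinOfCardEq hcard).symm
  choose v p c h hp using fun i => hS _ (hTS (e i).2)
  -- Orthogonal null vectors are proportional, and proportional contact points have the same tangent
  -- plane.
  have hne : ∀ i j, i ≠ j → lp (p i) (p j) ≠ 0 := fun i j hij h0 => by
    apply hij
    apply e.injective
    apply Subtype.ext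
    have hl := null_orthogonal (hp i) (hp j) h0
    have li := last_ne_zero_of_null (hp i) (h i).contact_ne_zero
    have lj := last_ne_zero_of_null (hp j) (h j).contact_ne_zero
    ext w
    rw [(h i).normal.mem_iff, (h j).normal.mem_iff]
    have e' := congrArg (bil K w) hl
    rw [bil_smul_right, bil_smul_right, (h i).bil_contact, (h j).bil_contact] at e'
    constructor
    · intro h1
      rw [h1, mul_zero, mul_zero] at e'
      exact (mul_eq_zero.mp ((mul_eq_zero.mp e'.symm).resolve_left li)).resolve_left (h j).ne_zero
    · intro h1
      rw [h1, mul_zero, mul_zero] at e'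
      exact (mul_eq_zero.mp ((mul_eq_zero.mp e').resolve_left lj)).resolve_left (h i).ne_zero
  have hk := (h 0).apex_ne_zero
  have ho := fun i => (h i).orthogonal
  have hi : ∀ a b c, a ≠ b → b ≠ c → a ≠ c → ∀ r s t : ℝ, r • p a + s • p b + t • p c = 0 →
      r = 0 ∧ s = 0 ∧ t = 0 := fun a b c h1 h2 h3 r s t =>
    coeff_eq_zero_of_null_triple lorentz_isSymm (hp a) (hp b) (hp c) (hne a b h1) (hne a c h3)
      (hne b c h2)
  have h01 := hne 0 1 (by decide)
  have hKs := (h 0).symm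
  -- Both forms vanish at the five points; this member of their pencil also makes the first two
  -- points conjugate, so the five point lemma applies.
  set ρ := bil K (p 0) (p 1) / lp (p 0) (p 1) with hρ
  obtain ⟨h02, -⟩ := conjugate_of_five_points (B := fun x y => bil K x y - ρ * lp x y)
    (fun x y => by rw [bil_comm hKs, lp_comm])
    (fun r t u x y z w => by
      simp only [bil_add_left, bil_smul_left]
      ring) hk ho (fun i => by rw [(h i).null, hp i, mul_zero, sub_zero]) hi (by
      rw [hρ, div_mul_cancel₀ _ h01, sub_self])
  have e01 : bil K (p 0) (p 1) = ρ * lp (p 0) (p 1) := by rw [hρ, div_mul_cancel₀ _ h01]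
  have e02 : bil K (p 0) (p 2) = ρ * lp (p 0) (p 2) := by linarith
  have e00 : bil K (p 0) (p 0) = ρ * lp (p 0) (p 0) := by rw [(h 0).null, hp 0, mul_zero]
  rw [bil_comm hKs, (h 0).bil_contact] at e00 e01 e02
  have kv := (lp_comm k (v 0)).trans (h 0).lp_normal_apex
  have ko := fun i => (lp_comm (p i) k).trans (ho i)
  -- Thus `c 0 • v 0 - ρ • p 0` is a multiple of the apex. Pairing with `k` shows that it is zero,
  -- and pairing with `v 0` then forces `c 0 = 0`.
  obtain ⟨t, ht⟩ := eq_smul_of_orthogonal_triple (hi 0 1 2 (by decide) (by decide) (by decide))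
    hk (ko 0) (ko 1) (ko 2) (x := c 0 • v 0 - ρ • p 0)
    (by rw [lp_comm, lp_sub_left, lp_smul_left, lp_smul_left]; linarith)
    (by rw [lp_comm, lp_sub_left, lp_smul_left, lp_smul_left]; linarith)
    (by rw [lp_comm, lp_sub_left, lp_smul_left, lp_smul_left]; linarith)
  have ht0 : t = 0 := by
    have := congrArg (lp k) ht
    rw [lp_sub_right, lp_smul_right, lp_smul_right, lp_smul_right, kv, ho 0] at this
    simpa [(h 0).apex] using this.symm
  rw [ht0, zero_smul, sub_eq_zero] at ht
  have := congrArg (fun x => lp x (v 0)) ht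
  simp only [lp_smul_left] at this
  rw [(h 0).normal.unit, lp_comm, (h 0).lp_contact] at this
  apply (h 0).ne_zero
  linarith

theorem rank_eq_three (hker : ∀ x, K.mulVec x = 0 ↔ ∃ t : ℝ, x = t • k)
    (hk : k ≠ 0) : K.rank = 3 := by
  have h1 := K.mulVecLin.finrank_range_add_finrank_ker
  have h2 : LinearMap.ker K.mulVecLin = Submodule.span ℝ {k} := by
    ext x
    rw [LinearMap.mem_ker, Matrix.mulVecLin_apply, hker, Submodule.mem_span_singleton]
    exact ⟨fun ⟨t, ht⟩ => ⟨t, ht.symm⟩, fun ⟨t, ht⟩ => ⟨t, ht.symm⟩⟩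
  rw [h2, finrank_span_singleton hk, show Module.finrank ℝ (Fin (2 + 2) → ℝ) = 4 by simp] at h1
  rw [Matrix.rank]
  omega

variable {D : DarbouxCyclide 2} {a b : ℝ} {v : ℤ → Vec 2} {W : ℤ → Submodule ℝ (Vec 2)}

/-- Planes in general position that are tangent to a singular quadric of the pencil cut out
circles that envelop the cyclic and are twice tangent to it. -/
theorem envelop_of_tangent (hb : b ≠ 0) (hW : ∀ i, Module.finrank ℝ (W i) = 3)
    (hv : ∀ i, IsUnitNormal (v i) (W i)) (hg : GeneralPosition W)
    (hk : ∃ k : Vec 2, k ≠ 0 ∧ (a • lorentz 2 + b • D.form).mulVec k = 0)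
    (ht : ∀ i, ∃ (p : Vec 2) (c : ℝ), c ≠ 0 ∧
      (a • lorentz 2 + b • D.form).mulVec p = c • (lorentz 2).mulVec (v i) ∧
      bil (a • lorentz 2 + b • D.form) p p = 0) :
    Envelop W D ∧ (∀ i, D.TwiceTangent (W i)) ∧
      {U | U ∈ Set.range W ∧ ¬ D.TangentAtTwoPoints U}.encard ≤ 4 := by
  obtain ⟨k, hk0, hKk⟩ := hk
  set K := a • lorentz 2 + b • D.form with hKdef
  have hK : K.IsSymm := (lorentz_isSymm.smul a).add (D.symm.smul b)
  have hperp : ∀ x, K.mulVec x = 0 → ∀ i, lp (v i) x = 0 := fun x hx i => by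
    obtain ⟨p, c, hc, hp, -⟩ := ht i
    have : bil K x p = c * lp (v i) x := by
      rw [bil, hp, dotProduct_smul, smul_eq_mul, lp_comm]; rfl
    rw [bil_comm hK, bil, hx, dotProduct_zero] at this
    simpa [hc] using this.symm
  have hi := hg.normalsIndependent hv
  have hker : ∀ x, K.mulVec x = 0 ↔ ∃ t : ℝ, x = t • k := fun x => by
    constructor
    · intro hx
      exact eq_smul_of_orthogonal_triple
        (fun a b c => hi 0 1 2 (by decide) (by decide) (by decide) a b c) hk0
        (hperp k hKk _) (hperp k hKk _) (hperp k hKk _) (hperp x hx _) (hperp x hx _)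
        (hperp x hx _)
    · rintro ⟨t, rfl⟩
      rw [Matrix.mulVec_smul, hKk, smul_zero]
  -- A null apex would be a point common to all the circles.
  have hapex : lp k k ≠ 0 := fun h0 => by
    apply hg.no_common_point
    refine ⟨Projectivization.mk ℝ k hk0, fun i => ⟨fun x hx => ?_, ?_⟩⟩
    · rw [Projectivization.submodule_mk] at hx
      obtain ⟨t, rfl⟩ := Submodule.mem_span_singleton.mp hx
      change lp _ _ = 0
      rw [lp_smul_left, lp_smul_right, h0, mul_zero, mul_zero]
    · rw [Projectivization.submodule_mk, Submodule.span_singleton_le_iff_mem, (hv i).mem_iff]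
      exact hperp k hKk i
  have touch : ∀ i, ∃ (p : Vec 2) (c : ℝ), TouchesCone K k (v i) p c (W i) := fun i => by
    obtain ⟨p, c, hc, hp, hpp⟩ := ht i
    -- Moving the contact point along the generator of the cone makes it orthogonal to the apex
    -- without changing its polar plane.
    refine ⟨p - (lp k p / lp k k) • k, c, hK, hker, hapex, hW i, hv i, hc, ?_, ?_, ?_⟩
    · rw [Matrix.mulVec_sub, Matrix.mulVec_smul, hKk, smul_zero, sub_zero, hp]
    · have hz : ∀ x, bil K x k = 0 := fun x => by rw [bil, hKk, dotProduct_zero]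
      simp only [bil_sub_left, bil_sub_right, bil_smul_left, bil_smul_right, hz, bil_comm hK k, hpp]
      ring
    · rw [lp_sub_right, lp_smul_right, div_mul_cancel₀ _ hapex, sub_self]
  refine ⟨⟨a, b, hb, rank_eq_three hker hk0, fun i => ?_⟩, fun i => ?_, ?_⟩
  · obtain ⟨p, c, h⟩ := touch i
    refine ⟨p, ?_, h.null, fun w => ?_⟩
    · intro h0
      have := h.bil_contact (v i)
      rw [bil, hKdef, h0, dotProduct_zero, (hv i).unit, mul_one] at this
      exact h.ne_zero this.symm
    · rw [← hKdef, h.bil_contact, (hv i).mem_iff, mul_eq_zero, or_iff_right h.ne_zero]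
  · obtain ⟨p, c, h⟩ := touch i
    by_cases hpp : lp p p = 0
    · exact Or.inr (h.tangentAtDoublePoint hb hpp)
    · exact Or.inl (h.tangentAtTwoPoints hb hpp)
  · apply encard_le_four (K := K) (k := k)
    rintro _ ⟨⟨i, rfl⟩, hU⟩
    obtain ⟨p, c, h⟩ := touch i
    refine ⟨v i, p, c, h, ?_⟩
    by_contra hpp
    exact hU (h.tangentAtTwoPoints hb hpp)

theorem exists_cyclic {M : ℤ → ℤ → RP 2} {V H : ℤ → Submodule ℝ (Vec 2)}
    (hM : IsCircularNet M) (hc : HasCircularLines M V H) (he : EdgesNotConcurrent M)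
    (hV : GeneralPosition V) (hH : GeneralPosition H) :
    ∃ D : DarbouxCyclide 2, Envelop V D ∧ Envelop H D ∧
      (∀ i, D.TwiceTangent (V i)) ∧ (∀ j, D.TwiceTangent (H j)) ∧
      {W | W ∈ Set.range V ∧ ¬ D.TangentAtTwoPoints W}.encard ≤ 4 ∧
      {W | W ∈ Set.range H ∧ ¬ D.TangentAtTwoPoints W}.encard ≤ 4 := by
  have hm := hM.nullNet
  have hmV : ∀ i j, (M i j).rep ∈ V i := fun i j => (mem_sphere_iff.mp (hc.mem_V i j)).2
  have hmH : ∀ i j, (M i j).rep ∈ H j := fun i j => (mem_sphere_iff.mp (hc.mem_H i j)).2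
  choose v hv using fun i => exists_isUnitNormal (hc.finrank_V i) (hmV i 0) (hmV i (0 + 1))
    (hm.null i 0) (hm.snd i 0)
  choose h hh using fun j => exists_isUnitNormal (hc.finrank_H j) (hmH 0 j) (hmH (0 + 1) j)
    (hm.null 0 j) (hm.fst 0 j)
  have iv := hV.normalsIndependent hv
  have ih := hH.normalsIndependent hh
  obtain ⟨s, r, hd⟩ := hm.stripData hc.finrank_H hmH hmV hh hv ih fun j T hT => by
    have hmem : ∀ i, T ∈ (M i j).submodule ⊔ (M i (j + 1)).submodule := fun i => by
      obtain ⟨a, b, e⟩ := hT i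
      rw [e, Projectivization.submodule_eq, Projectivization.submodule_eq]
      exact Submodule.add_mem_sup
        (Submodule.smul_mem _ _ (Submodule.mem_span_singleton_self _))
        (Submodule.smul_mem _ _ (Submodule.mem_span_singleton_self _))
    rw [← Submodule.mem_bot ℝ, ← he.fst 0 j]
    exact ⟨⟨hmem _, hmem _⟩, hmem _⟩
  obtain ⟨K, hK, hkV, hkH, htV, htH⟩ :=
    hd.exists_cone ih iv (fun j => (hh j).unit) (fun i => (hv i).unit)
  let D : DarbouxCyclide 2 :=
    { form := K
      symm := hK
      ne_lorentz := by
        rintro c rfl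
        obtain ⟨k, hk, hk0⟩ := hkV
        obtain ⟨p, t, ht, hp, -⟩ := htV 0
        rw [Matrix.smul_mulVec, smul_eq_zero] at hk0
        rcases hk0 with h0 | h0
        · rw [h0, zero_smul, Matrix.zero_mulVec] at hp
          have := congrArg (dotProduct (v 0)) hp
          rw [dotProduct_zero, dotProduct_smul, smul_eq_mul, zero_eq_mul] at this
          rcases this with h1 | h1
          · exact ht h1
          · have h2 := (hv 0).unit
            rw [lp, bil, h1] at h2
            exact zero_ne_one h2
        · apply hk
          rw [← lorentz_mulVec_mulVec k, h0, Matrix.mulVec_zero] }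
  -- The enveloping cones are the pencil members with coefficients `(0, 1)` for the planes `V i` and
  -- `(-1, 1)` for the planes `H j`.
  have eV : (0 : ℝ) • lorentz 2 + (1 : ℝ) • D.form = K := by rw [zero_smul, one_smul, zero_add]
  have eH : (-1 : ℝ) • lorentz 2 + (1 : ℝ) • D.form = K - lorentz 2 := by
    rw [one_smul, neg_one_smul, neg_add_eq_sub]
  obtain ⟨v1, v2, v3⟩ := envelop_of_tangent (D := D) (a := 0) (b := 1) one_ne_zero hc.finrank_V hv
    hV (by rw [eV]; exact hkV) (by rw [eV]; exact htV)
  obtain ⟨h1, h2, h3⟩ := envelop_of_tangent (D := D) (a := -1) (b := 1) one_ne_zero hc.finrank_H hh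
    hH (by rw [eH]; exact hkH) (by rw [eH]; exact htH)
  exact ⟨D, v1, h1, v2, h2, v3, h3⟩

end Families

end CircularNets

theorem mainTheorem8 :
    (∀ (M : ℤ → ℤ → CircularNets.RP 3) (V H : ℤ → Submodule ℝ (CircularNets.Vec 3)),
      CircularNets.IsCircularNet M → CircularNets.HasCircularLines M V H →
      (∀ i, V i ≠ V (i + 1)) → (∀ j, H j ≠ H (j + 1)) →
      ∃ D : CircularNets.DarbouxCyclide 3,
        (∀ i, CircularNets.sphere (V i) ⊆ D.points) ∧
        (∀ j, CircularNets.sphere (H j) ⊆ D.points)) ∧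
    (∀ (M : ℤ → ℤ → CircularNets.RP 2) (V H : ℤ → Submodule ℝ (CircularNets.Vec 2)),
      CircularNets.IsCircularNet M → CircularNets.HasCircularLines M V H →
      CircularNets.EdgesNotConcurrent M →
      CircularNets.GeneralPosition V → CircularNets.GeneralPosition H →
      ∃ D : CircularNets.DarbouxCyclide 2,
        CircularNets.Envelop V D ∧ CircularNets.Envelop H D ∧
        (∀ i, D.TwiceTangent (V i)) ∧ (∀ j, D.TwiceTangent (H j)) ∧
        {W | W ∈ Set.range V ∧ ¬ D.TangentAtTwoPoints W}.encard ≤ 4 ∧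
        {W | W ∈ Set.range H ∧ ¬ D.TangentAtTwoPoints W}.encard ≤ 4) := by
  exact ⟨fun _ _ _ hM hc _ _ => CircularNets.exists_darbouxCyclide hM hc,
    fun _ _ _ hM hc he hV hH => CircularNets.exists_cyclic hM hc he hV hH⟩
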